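/- Let $\mathsf k$ be an algebraically closed field of characteristic $0$, let $m,n\ge 1$, and let $A_n$ be the $n$-th Weyl algebra over $\mathsf k$, generated by $x_1,\dots,x_n,\partial_1,\dots,\partial_n$ with $x_ix_j=x_jx_i$, $\partial_i\partial_j=\partial_j\partial_i$, $\partial_ix_j-x_j\partial_i=\delta_{ij}$. Put $t_i=\partial_ix_i$. Let $G_m$ be the group of $m$-th roots of unity of $\mathsf k$. The symmetric group $S_n$ acts on $A_n$ by $x_i\mapsto x_{\pi(i)}$, $\partial_i\mapsto\partial_{\pi(i)}$; the group $G_m^{\otimes n}$ (the product of $n$ copies of $G_m$) acts by $x_i\mapsto\zeta_i^{-1}x_i$, $\partial_i\mapsto\zeta_i\partial_i$; together they give an action of $G(m,1,n)=G_m^{\otimes n}\rtimes S_n$. The alternating group $\mathcal A_n\subset S_n$ acts by restriction. Let $L=\mathsf k(t_1,\dots,t_n)$ and let $\sigma_i\in\mathrm{Aut}_{\mathsf k}(L)$ be given by $\sigma_i(t_j)=t_j-\delta_{ij}$. For $r\ge 1$ let $\mathcal M_r\cong\mathbb Z^n$ be the subgroup of $\mathrm{Aut}_{\mathsf k}(L)$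 generated by $\sigma_1^r,\dots,\sigma_n^r$. In the skew group ring $L*\mathcal M_r$ one has $(am)(bm')=a\,m(b)\,mm'$, and a subgroup $G\subset \mathrm{Aut}_{\mathsf k}(L)$ that normalizes $\mathcal M_r$ acts on it by $g(am)=g(a)\,gmg^{-1}$. Definitions. (a) A commutative subalgebra $\Gamma$ of an algebra $U$ is a Harish-Chandra subalgebra if $\Gamma u\Gamma$ is finitely generated as a left and as a right $\Gamma$-module for every $u\in U$. (b) Let $\Gamma\subset L$ be a subalgebra with field of fractions $K$ such that $L/K$ is a finite Galois extension with group $G$, where $G$ normalizes a submonoid $\mathcal M\subset\mathrm{Aut}_{\mathsf k}(L)$ whose elements are determined by their restrictions to $K$. A subalgebra $U$ with $\Gamma\subset U\subset(L*\mathcal M)^G$ is a Galois ring over $\Gamma$ in $(L*\mathcal M)^G$ if it is generated as a ring by $\Gamma$ and finitely many elements and $KU=UK=(L*\mathcal M)^G$. It is a Galois order over $\Gamma$ if moreover, for every finite-dimensional left (respectively right) $K$-subspace $V\subset(L*\mathcal M)^G$, the intersection $V\cap U$ is a finitely generated left (respectively right) $\Gamma$-module. Theorem. The assignment $x_i\mapsto\sigma_i$,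 $\partial_i\mapsto t_i\sigma_i^{-1}$ defines an injective homomorphism $A_n\to L*\mathcal M_1$. Let $W$ be one of the groups $G(m,1,n)$, $\mathcal A_n$, $G_m^{\otimes n}$. Then $\Gamma=\mathsf k[t_1,\dots,t_n]^W$ is a Harish-Chandra subalgebra of $A_n^W$, and, under this embedding, $A_n^W$ is a Galois order over $\Gamma$ in the invariant skew group ring - $(L*\mathcal M_m)^{S_n}$ if $W=G(m,1,n)$; - $(L*\mathcal M_1)^{\mathcal A_n}$ if $W=\mathcal A_n$; - $L*\mathcal M_m$ if $W=G_m^{\otimes n}$; where $S_n$ and $\mathcal A_n$ act on $L$ by permuting $t_1,\dots,t_n$. -/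

import Mathlib

noncomputable section

/-! ### One-sided finite generation and Harish-Chandra subalgebras -/

section FG

variable {k A : Type*} [Field k] [Ring A] [Algebra k A]

/-- The subspace `V` of `A` is a finitely generated left `R`-submodule: `V = R T` with `T` finite. -/
def LeftFG (R : Subalgebra k A) (V : Submodule k A) : Prop :=
  ∃ T : Finset A, V = Subalgebra.toSubmodule R * Submodule.span k (T : Set A)

/-- The subspace `V` of `A` is a finitely generated right `R`-submodule: `V = T R` with `T` finite. -/
def RightFG (R : Subalgebra k A) (V : Submodule k A) : Prop :=
  ∃ T : Finset A, V = Submodule.span k (T : Set A) * Subalgebra.toSubmodule R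

/-- `Γ` is a Harish-Chandra subalgebra of the subalgebra `U` of `A`: it is commutative, and `Γ u Γ`
is a finitely generated left and right `Γ`-module for every `u` in `U`. -/
structure IsHarishChandra (Γ U : Subalgebra k A) : Prop where
  le : Γ ≤ U
  comm : ∀ a ∈ Γ, ∀ b ∈ Γ, a * b = b * a
  left : ∀ u ∈ U, LeftFG Γ
    (Subalgebra.toSubmodule Γ * Submodule.span k {u} * Subalgebra.toSubmodule Γ)
  right : ∀ u ∈ U, RightFG Γ
    (Subalgebra.toSubmodule Γ * Submodule.span k {u} * Subalgebra.toSubmodule Γ)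

end FG

/-! ### Skew monoid rings, Galois rings and Galois orders -/

section Galois

variable (k L : Type*) [Field k] [Field L] [Algebra k L]

/-- The skew group ring `L * Aut_k(L)`, with `(r g) (s h) = (r g(s)) (g h)`. The skew monoid ring
`L * M` of a submonoid `M` of `Aut_k(L)` is the subalgebra of the elements supported on `M`. -/
abbrev SkewAut : Type _ := SkewMonoidAlgebra L (L ≃ₐ[k] L)

/-- The inclusion of `L` into the skew group ring as the coefficients of the identity. -/
def skewCoeff : L →ₐ[k] SkewAut k L where
  __ := SkewMonoidAlgebra.singleOneRingHom
  commutes' _ := rfl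

variable {k L}

/-- The skew monoid ring `L * M`. -/
def skewMonoidRing (M : Submonoid (L ≃ₐ[k] L)) : Subalgebra k (SkewAut k L) where
  carrier := {x | ∀ g ∈ x.support, g ∈ M}
  mul_mem' := by
    classical
    intro a b ha hb g hg
    obtain ⟨g₁, h₁, g₂, h₂, rfl⟩ := Finset.mem_mul.1 (SkewMonoidAlgebra.support_mul a b hg)
    exact M.mul_mem (ha _ h₁) (hb _ h₂)
  add_mem' := by
    classical
    intro a b ha hb g hg
    rcases Finset.mem_union.1 (SkewMonoidAlgebra.support_add hg) with h | h
    · exact ha _ h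
    · exact hb _ h
  algebraMap_mem' := by
    intro r g hg
    have h : g ∈ (SkewMonoidAlgebra.single (1 : L ≃ₐ[k] L) (algebraMap k L r)).support := hg
    have h' := SkewMonoidAlgebra.support_single_subset h
    rw [Finset.mem_singleton] at h'
    exact h' ▸ M.one_mem

/-- The automorphism `r m ↦ g(r) (g m g⁻¹)` of the skew group ring given by `g` in `Aut_k(L)`;
it is realized as conjugation by `g`, see `skewConj_single`. -/
def skewConj (g : L ≃ₐ[k] L) : SkewAut k L →ₐ[k] SkewAut k L where
  toFun x := SkewMonoidAlgebra.single g 1 * x * SkewMonoidAlgebra.single g⁻¹ 1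
  map_one' := by simp
  map_mul' x y := by
    have h : (SkewMonoidAlgebra.single g⁻¹ 1 * SkewMonoidAlgebra.single g 1 : SkewAut k L) = 1 := by
      simp
    calc _ = SkewMonoidAlgebra.single g 1 * x * 1 * y * SkewMonoidAlgebra.single g⁻¹ 1 := by
          simp only [mul_one, mul_assoc]
      _ = _ := by rw [← h]; simp only [mul_assoc]
  map_zero' := by simp
  map_add' x y := by simp [mul_add, add_mul]
  commutes' r := by
    rw [← Algebra.commutes, mul_assoc]
    simp

theorem skewConj_single (g m : L ≃ₐ[k] L) (r : L) :
    skewConj g (SkewMonoidAlgebra.single m r) =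
      SkewMonoidAlgebra.single (g * m * g⁻¹) (g r) := by
  simp [skewConj]

/-- The invariant skew monoid ring `(L * M)^G`. -/
def invSkewMonoidRing (M : Submonoid (L ≃ₐ[k] L)) (G : Subgroup (L ≃ₐ[k] L)) :
    Subalgebra k (SkewAut k L) :=
  skewMonoidRing M ⊓ ⨅ g ∈ G, AlgHom.equalizer (skewConj g) (AlgHom.id k (SkewAut k L))

/-- The field of fractions, inside `L`, of a subalgebra `Γ` of `L` (viewed in the skew ring). -/
def fracField (Γ : Subalgebra k (SkewAut k L)) : IntermediateField k L :=
  IntermediateField.adjoin k {l : L | skewCoeff k L l ∈ Γ}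

/-- The field of fractions of `Γ`, as a subalgebra of the skew ring. -/
def fracAlg (Γ : Subalgebra k (SkewAut k L)) : Subalgebra k (SkewAut k L) :=
  (fracField Γ).toSubalgebra.map (skewCoeff k L)

/-- `U` is a Galois ring over `Γ` in `(L * M)^G`. Here `K = Frac Γ`, the extension `L / K` is finite
Galois with group `G`, the group `G` acts on the monoid `M` by conjugation, and elements of `M` with
the same restriction to `K` are equal. -/
structure IsGaloisRing (M : Submonoid (L ≃ₐ[k] L)) (G : Subgroup (L ≃ₐ[k] L))
    (Γ U : Subalgebra k (SkewAut k L)) : Prop where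
  coeff : Γ ≤ (skewCoeff k L).range
  finite : FiniteDimensional (fracField Γ) L
  galois : IsGalois (fracField Γ) L
  group : G = (fracField Γ).fixingSubgroup
  conj : ∀ g ∈ G, ∀ m ∈ M, g * m * g⁻¹ ∈ M
  separating : ∀ m ∈ M, ∀ m' ∈ M, (∀ c ∈ fracField Γ, m c = m' c) → m = m'
  base_le : Γ ≤ U
  le : U ≤ invSkewMonoidRing M G
  fg : ∃ S : Finset (SkewAut k L), U = Algebra.adjoin k ((Γ : Set (SkewAut k L)) ∪ (S : Set _))
  left_span : Subalgebra.toSubmodule (fracAlg Γ) * Subalgebra.toSubmodule U =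
    Subalgebra.toSubmodule (invSkewMonoidRing M G)
  right_span : Subalgebra.toSubmodule U * Subalgebra.toSubmodule (fracAlg Γ) =
    Subalgebra.toSubmodule (invSkewMonoidRing M G)

/-- `U` is a Galois order over `Γ` in `(L * M)^G`: a Galois ring such that `V ∩ U` is a finitely
generated left (right) `Γ`-module for each finite-dimensional left (right) `Frac Γ`-subspace `V`
of `(L * M)^G`. -/
structure IsGaloisOrder (M : Submonoid (L ≃ₐ[k] L)) (G : Subgroup (L ≃ₐ[k] L))
    (Γ U : Subalgebra k (SkewAut k L)) : Prop extends IsGaloisRing M G Γ U where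
  left_order : ∀ V : Submodule k (SkewAut k L),
    V ≤ Subalgebra.toSubmodule (invSkewMonoidRing M G) → LeftFG (fracAlg Γ) V →
      LeftFG Γ (V ⊓ Subalgebra.toSubmodule U)
  right_order : ∀ V : Submodule k (SkewAut k L),
    V ≤ Subalgebra.toSubmodule (invSkewMonoidRing M G) → RightFG (fracAlg Γ) V →
      RightFG Γ (V ⊓ Subalgebra.toSubmodule U)

end Galois

/-! ### The Weyl algebra -/

section Weyl

variable (k : Type*) [Field k] (n : ℕ)

/-- The defining relations of the Weyl algebra; `Sum.inl i` stands for `x_i` and `Sum.inr i`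
for `∂_i`. -/
inductive WeylRel : FreeAlgebra k (Fin n ⊕ Fin n) → FreeAlgebra k (Fin n ⊕ Fin n) → Prop
  | x_comm (i j : Fin n) : WeylRel
      (FreeAlgebra.ι k (Sum.inl i) * FreeAlgebra.ι k (Sum.inl j))
      (FreeAlgebra.ι k (Sum.inl j) * FreeAlgebra.ι k (Sum.inl i))
  | d_comm (i j : Fin n) : WeylRel
      (FreeAlgebra.ι k (Sum.inr i) * FreeAlgebra.ι k (Sum.inr j))
      (FreeAlgebra.ι k (Sum.inr j) * FreeAlgebra.ι k (Sum.inr i))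
  | d_x (i j : Fin n) : WeylRel
      (FreeAlgebra.ι k (Sum.inr i) * FreeAlgebra.ι k (Sum.inl j) -
        FreeAlgebra.ι k (Sum.inl j) * FreeAlgebra.ι k (Sum.inr i))
      (if i = j then 1 else 0)

/-- The `n`-th Weyl algebra over `k`. -/
def WeylAlgebra : Type _ := RingQuot (WeylRel k n)

instance : Ring (WeylAlgebra k n) := inferInstanceAs (Ring (RingQuot (WeylRel k n)))

instance : Algebra k (WeylAlgebra k n) := inferInstanceAs (Algebra k (RingQuot (WeylRel k n)))

/-- The quotient map from the free algebra. -/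
def WeylAlgebra.mk : FreeAlgebra k (Fin n ⊕ Fin n) →ₐ[k] WeylAlgebra k n :=
  RingQuot.mkAlgHom k (WeylRel k n)

namespace WeylAlgebra

variable {n}

/-- The generator `x_i`. -/
def x (i : Fin n) : WeylAlgebra k n :=
  mk k n (FreeAlgebra.ι k (Sum.inl i))

/-- The generator `∂_i`. -/
def d (i : Fin n) : WeylAlgebra k n :=
  mk k n (FreeAlgebra.ι k (Sum.inr i))

/-- The element `t_i = ∂_i x_i`. -/
def t (i : Fin n) : WeylAlgebra k n := d k i * x k i

theorem mk_rel {a b : FreeAlgebra k (Fin n ⊕ Fin n)} (h : WeylRel k n a b) :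
    mk k n a = mk k n b := RingQuot.mkAlgHom_rel k h

theorem x_mul_x (i j : Fin n) : x k i * x k j = x k j * x k i := by
  simpa [x] using mk_rel k (WeylRel.x_comm (k := k) i j)

theorem d_mul_d (i j : Fin n) : d k i * d k j = d k j * d k i := by
  simpa [d] using mk_rel k (WeylRel.d_comm (k := k) i j)

theorem d_mul_x (i j : Fin n) :
    d k i * x k j - x k j * d k i = if i = j then 1 else 0 := by
  have h := mk_rel k (WeylRel.d_x (k := k) i j)
  split_ifs at h ⊢ with hij <;> simpa [d, x] using h

variable {k}

/-- The homomorphism from the Weyl algebra given by elements that satisfy its relations. -/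
def lift {B : Type*} [Ring B] [Algebra k B] (X D : Fin n → B)
    (hX : ∀ i j, X i * X j = X j * X i) (hD : ∀ i j, D i * D j = D j * D i)
    (hDX : ∀ i j, D i * X j - X j * D i = if i = j then 1 else 0) :
    WeylAlgebra k n →ₐ[k] B :=
  RingQuot.liftAlgHom k ⟨FreeAlgebra.lift k (Sum.elim X D), by
    intro a b h
    cases h with
    | x_comm i j => simpa using hX i j
    | d_comm i j => simpa using hD i j
    | d_x i j =>
      have := hDX i j
      split_ifs at this ⊢ with hij <;> simpa using this⟩

section lift

variable {B : Type*} [Ring B] [Algebra k B] (X D : Fin n → B)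
    (hX : ∀ i j, X i * X j = X j * X i) (hD : ∀ i j, D i * D j = D j * D i)
    (hDX : ∀ i j, D i * X j - X j * D i = if i = j then 1 else 0)

theorem lift_x (i : Fin n) : lift (k := k) X D hX hD hDX (x k i) = X i :=
  (RingQuot.liftAlgHom_mkAlgHom_apply _ _ _ _).trans (by simp)

theorem lift_d (i : Fin n) : lift (k := k) X D hX hD hDX (d k i) = D i :=
  (RingQuot.liftAlgHom_mkAlgHom_apply _ _ _ _).trans (by simp)

theorem hom_ext {f g : WeylAlgebra k n →ₐ[k] B} (hx : ∀ i, f (x k i) = g (x k i))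
    (hd : ∀ i, f (d k i) = g (d k i)) : f = g := by
  refine RingQuot.ringQuot_ext' (s := WeylRel k n) k f g ?_
  apply FreeAlgebra.hom_ext
  funext s
  cases s with
  | inl i => exact hx i
  | inr i => exact hd i

end lift

/-- The endomorphism `x_i ↦ (a i)⁻¹ x_i`, `∂_i ↦ (a i) ∂_i`. -/
def torusHom (a : Fin n → kˣ) : WeylAlgebra k n →ₐ[k] WeylAlgebra k n :=
  lift (fun i => (((a i)⁻¹ : kˣ) : k) • x k i) (fun i => (a i : k) • d k i)
    (fun i j => by
      simp only [smul_mul_smul_comm]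
      rw [x_mul_x, mul_comm])
    (fun i j => by
      simp only [smul_mul_smul_comm]
      rw [d_mul_d, mul_comm])
    (fun i j => by
      have h := d_mul_x k i j
      simp only [smul_mul_smul_comm]
      rw [mul_comm (((a j)⁻¹ : kˣ) : k), ← smul_sub, h]
      split_ifs with hij
      · subst hij; simp
      · simp)

theorem torusHom_x (a : Fin n → kˣ) (i : Fin n) :
    torusHom a (x k i) = (((a i)⁻¹ : kˣ) : k) • x k i := lift_x _ _ _ _ _ i

theorem torusHom_d (a : Fin n → kˣ) (i : Fin n) :
    torusHom a (d k i) = (a i : k) • d k i := lift_d _ _ _ _ _ i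

theorem torusHom_mul (a b : Fin n → kˣ) :
    torusHom (a * b) = (torusHom a).comp (torusHom b) :=
  hom_ext (fun i => by simp [torusHom_x, smul_smul, mul_comm])
    (fun i => by simp [torusHom_d, smul_smul, mul_comm])

theorem torusHom_one : torusHom (1 : Fin n → kˣ) = AlgHom.id k _ :=
  hom_ext (fun i => by simp [torusHom_x]) (fun i => by simp [torusHom_d])

/-- The action of diagonal matrices on the Weyl algebra. -/
def torusAct : (Fin n → kˣ) →* (WeylAlgebra k n ≃ₐ[k] WeylAlgebra k n) where
  toFun a := AlgEquiv.ofAlgHom (torusHom a) (torusHom a⁻¹)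
    (by rw [← torusHom_mul, mul_inv_cancel, torusHom_one])
    (by rw [← torusHom_mul, inv_mul_cancel, torusHom_one])
  map_one' := AlgEquiv.ext fun u => DFunLike.congr_fun torusHom_one u
  map_mul' a b := AlgEquiv.ext fun u => DFunLike.congr_fun (torusHom_mul a b) u

/-- The endomorphism `x_i ↦ x_{π i}`, `∂_i ↦ ∂_{π i}`. -/
def permHom (π : Equiv.Perm (Fin n)) : WeylAlgebra k n →ₐ[k] WeylAlgebra k n :=
  lift (fun i => x k (π i)) (fun i => d k (π i)) (fun _ _ => x_mul_x k _ _)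
    (fun _ _ => d_mul_d k _ _) (fun i j => by simp [d_mul_x])

theorem permHom_x (π : Equiv.Perm (Fin n)) (i : Fin n) :
    permHom π (x k i) = x k (π i) := lift_x _ _ _ _ _ i

theorem permHom_d (π : Equiv.Perm (Fin n)) (i : Fin n) :
    permHom π (d k i) = d k (π i) := lift_d _ _ _ _ _ i

theorem permHom_mul (π τ : Equiv.Perm (Fin n)) :
    permHom (k := k) (π * τ) = (permHom π).comp (permHom τ) :=
  hom_ext (fun i => by simp [permHom_x]) (fun i => by simp [permHom_d])

theorem permHom_one : permHom (1 : Equiv.Perm (Fin n)) = AlgHom.id k _ :=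
  hom_ext (fun i => by simp [permHom_x]) (fun i => by simp [permHom_d])

/-- The action of the symmetric group on the Weyl algebra. -/
def permAct : Equiv.Perm (Fin n) →* (WeylAlgebra k n ≃ₐ[k] WeylAlgebra k n) where
  toFun π := AlgEquiv.ofAlgHom (permHom π) (permHom π⁻¹)
    (by rw [← permHom_mul, mul_inv_cancel, permHom_one])
    (by rw [← permHom_mul, inv_mul_cancel, permHom_one])
  map_one' := AlgEquiv.ext fun u => DFunLike.congr_fun permHom_one u
  map_mul' a b := AlgEquiv.ext fun u => DFunLike.congr_fun (permHom_mul a b) u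

end WeylAlgebra

open WeylAlgebra

/-! ### The three groups and their actions -/

/-- The product `G_m^{⊗ n}` of `n` copies of the cyclic group of `m`-th roots of unity of `k`. -/
abbrev CyclicProduct (m : ℕ) : Type _ := Fin n → rootsOfUnity m k

/-- The group `G(m,1,n) = G_m^{⊗ n} ⋊ S_n`, where `S_n` permutes the entries. -/
abbrev ShephardTodd (m : ℕ) : Type _ :=
  CyclicProduct k n m ⋊[mulAutArrow (G := Equiv.Perm (Fin n)) (A := Fin n)
    (M := rootsOfUnity m k)] Equiv.Perm (Fin n)

/-- The action of `G_m^{⊗ n}` on the Weyl algebra: `ζ` in the `i`-th factor acts by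
`∂_i ↦ ζ ∂_i`, `x_i ↦ ζ⁻¹ x_i`, and fixes the other generators. -/
def cyclicAct (m : ℕ) : CyclicProduct k n m →* (WeylAlgebra k n ≃ₐ[k] WeylAlgebra k n) :=
  torusAct.comp ((rootsOfUnity m k).subtype.compLeft (Fin n))

/-- The action of `G(m,1,n)` on the Weyl algebra. -/
def shephardToddAct (m : ℕ) : ShephardTodd k n m →* (WeylAlgebra k n ≃ₐ[k] WeylAlgebra k n) :=
  SemidirectProduct.lift (cyclicAct k n m) permAct (by
    intro π
    apply MonoidHom.ext
    intro a
    apply AlgEquiv.coe_toAlgHom_injective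
    apply hom_ext
    · intro i
      change torusHom _ _ = permHom π (torusHom _ (permHom π⁻¹ _))
      simp [permHom_x, torusHom_x, mulAutArrow_apply_apply]
      rfl
    · intro i
      change torusHom _ _ = permHom π (torusHom _ (permHom π⁻¹ _))
      simp [permHom_d, torusHom_d, mulAutArrow_apply_apply]
      rfl)

/-- The action of the alternating group on the Weyl algebra. -/
def alternatingAct : alternatingGroup (Fin n) →* (WeylAlgebra k n ≃ₐ[k] WeylAlgebra k n) :=
  permAct.comp (alternatingGroup (Fin n)).subtype

variable {k n}

/-- The invariant subalgebra `A_n^W`. -/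
def weylInvariants {W : Type*} [Group W] (ρ : W →* (WeylAlgebra k n ≃ₐ[k] WeylAlgebra k n)) :
    Subalgebra k (WeylAlgebra k n) :=
  ⨅ w : W, AlgHom.equalizer (ρ w : WeylAlgebra k n →ₐ[k] WeylAlgebra k n) (AlgHom.id k _)

/-- The subalgebra `k[t_1, …, t_n]^W` of the Weyl algebra. -/
def tInvariants {W : Type*} [Group W] (ρ : W →* (WeylAlgebra k n ≃ₐ[k] WeylAlgebra k n)) :
    Subalgebra k (WeylAlgebra k n) :=
  Algebra.adjoin k (Set.range (t k)) ⊓ weylInvariants ρ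

variable (k n)

/-! ### The field `k(t_1, …, t_n)` and the embedding of the Weyl algebra -/

/-- The field `k(t_1, …, t_n)`. -/
abbrev RatField : Type _ := FractionRing (MvPolynomial (Fin n) k)

/-- The variable `t_i` of `k(t_1, …, t_n)`. -/
def ratVar (i : Fin n) : RatField k n := algebraMap (MvPolynomial (Fin n) k) _ (MvPolynomial.X i)

/-- The extension of automorphisms of `k[t_1, …, t_n]` to `k(t_1, …, t_n)`. -/
def ratExtend : (MvPolynomial (Fin n) k ≃ₐ[k] MvPolynomial (Fin n) k) →*
    (RatField k n ≃ₐ[k] RatField k n) :=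
  haveI : IsFractionRing k k := IsFractionRing.idem k k
  IsFractionRing.fieldEquivOfAlgEquivHom k (RatField k n)

theorem ratExtend_ratVar (f : MvPolynomial (Fin n) k ≃ₐ[k] MvPolynomial (Fin n) k) (i : Fin n) :
    ratExtend k n f (ratVar k n i) = algebraMap _ _ (f (MvPolynomial.X i)) := by
  simp [ratExtend, ratVar]

/-- The endomorphism `t_i ↦ t_i - a i` of `k[t_1, …, t_n]`. -/
def polyShiftHom (a : Fin n → ℤ) : MvPolynomial (Fin n) k →ₐ[k] MvPolynomial (Fin n) k :=
  MvPolynomial.aeval fun i => MvPolynomial.X i - MvPolynomial.C (a i : k)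

theorem polyShiftHom_add (a b : Fin n → ℤ) :
    polyShiftHom k n (a + b) = (polyShiftHom k n a).comp (polyShiftHom k n b) :=
  MvPolynomial.algHom_ext fun i => by
    simp [polyShiftHom, sub_sub]

theorem polyShiftHom_zero : polyShiftHom k n 0 = AlgHom.id k _ :=
  MvPolynomial.algHom_ext fun i => by simp [polyShiftHom]

/-- The action of `ℤ^n` on `k[t_1, …, t_n]` by shifts. -/
def polyShift :
    Multiplicative (Fin n → ℤ) →* (MvPolynomial (Fin n) k ≃ₐ[k] MvPolynomial (Fin n) k) where
  toFun a := AlgEquiv.ofAlgHom (polyShiftHom k n a.toAdd) (polyShiftHom k n (-a.toAdd))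
    (by rw [← polyShiftHom_add, add_neg_cancel, polyShiftHom_zero])
    (by rw [← polyShiftHom_add, neg_add_cancel, polyShiftHom_zero])
  map_one' := AlgEquiv.ext fun u => DFunLike.congr_fun (polyShiftHom_zero k n) u
  map_mul' a b := AlgEquiv.ext fun u =>
    DFunLike.congr_fun (polyShiftHom_add k n a.toAdd b.toAdd) u

/-- The action of `ℤ^n` on `k(t_1, …, t_n)` in which `a` sends `t_i` to `t_i - a i`. -/
def shift : Multiplicative (Fin n → ℤ) →* (RatField k n ≃ₐ[k] RatField k n) :=
  (ratExtend k n).comp (polyShift k n)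

theorem shift_ratVar (a : Multiplicative (Fin n → ℤ)) (i : Fin n) :
    shift k n a (ratVar k n i) =
      ratVar k n i - algebraMap k (RatField k n) (a.toAdd i : k) := by
  change ratExtend k n (polyShift k n a) _ = _
  rw [ratExtend_ratVar]
  change algebraMap _ _ (polyShiftHom k n a.toAdd (MvPolynomial.X i)) = _
  rw [polyShiftHom, MvPolynomial.aeval_X, map_sub,
    IsScalarTower.algebraMap_apply k (MvPolynomial (Fin n) k) (RatField k n)]
  rfl

/-- In characteristic zero `ℤ^n` acts faithfully. -/
theorem shift_injective [CharZero k] : Function.Injective (shift k n) := by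
  intro a b h
  have hi : ∀ i, a.toAdd i = b.toAdd i := by
    intro i
    have := DFunLike.congr_fun h (ratVar k n i)
    rw [shift_ratVar, shift_ratVar, sub_right_inj] at this
    exact_mod_cast (algebraMap k (RatField k n)).injective this
  exact Multiplicative.toAdd.injective (funext hi)

/-- The automorphism `σ_i` of `k(t_1, …, t_n)` with `σ_i(t_j) = t_j - δ_{ij}`. -/
def sigma (i : Fin n) : RatField k n ≃ₐ[k] RatField k n :=
  shift k n (Multiplicative.ofAdd (Pi.single i 1))

/-- The free abelian group on `σ_1^m, …, σ_n^m`, as a submonoid of `Aut_k(k(t_1, …, t_n))`. -/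
def shiftMonoid (m : ℕ) : Submonoid (RatField k n ≃ₐ[k] RatField k n) :=
  (Subgroup.closure (Set.range fun i => sigma k n i ^ m)).toSubmonoid

/-- The action of `S_n` on `k(t_1, …, t_n)`, `π(t_i) = t_{π i}`. -/
def permRat : Equiv.Perm (Fin n) →* (RatField k n ≃ₐ[k] RatField k n) :=
  (ratExtend k n).comp
    { toFun := fun π => MvPolynomial.renameEquiv k π
      map_one' := AlgEquiv.coe_toAlgHom_injective
        (MvPolynomial.algHom_ext fun i => by simp)
      map_mul' := fun π τ => AlgEquiv.coe_toAlgHom_injective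
        (MvPolynomial.algHom_ext fun i => by simp) }

theorem permRat_ratVar (π : Equiv.Perm (Fin n)) (i : Fin n) :
    permRat k n π (ratVar k n i) = ratVar k n (π i) := by
  change ratExtend k n (MvPolynomial.renameEquiv k π) _ = _
  rw [ratExtend_ratVar]
  simp [ratVar]

theorem sigma_ratVar (i j : Fin n) :
    sigma k n i (ratVar k n j) = ratVar k n j - if i = j then 1 else 0 := by
  rw [sigma, shift_ratVar]
  by_cases h : i = j
  · subst h; simp
  · simp [h]

theorem sigma_inv_ratVar (i j : Fin n) :
    (sigma k n i)⁻¹ (ratVar k n j) = ratVar k n j + if i = j then 1 else 0 := by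
  rw [sigma, ← map_inv, shift_ratVar]
  by_cases h : i = j
  · subst h; simp
  · simp [h]

theorem sigma_comm (i j : Fin n) : sigma k n i * sigma k n j = sigma k n j * sigma k n i := by
  simp only [sigma, ← map_mul, mul_comm]

/-- The homomorphism `x_i ↦ σ_i`, `∂_i ↦ t_i σ_i⁻¹` from the Weyl algebra to the skew ring. -/
def weylEmbedding : WeylAlgebra k n →ₐ[k] SkewAut k (RatField k n) :=
  WeylAlgebra.lift (fun i => SkewMonoidAlgebra.single (sigma k n i) 1)
    (fun i => SkewMonoidAlgebra.single (sigma k n i)⁻¹ (ratVar k n i))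
    (fun i j => by simp [sigma_comm k n i j])
    (fun i j => by
      have h : (sigma k n i)⁻¹ * (sigma k n j)⁻¹ = (sigma k n j)⁻¹ * (sigma k n i)⁻¹ := by
        rw [← mul_inv_rev, ← mul_inv_rev, sigma_comm]
      simp only [SkewMonoidAlgebra.single_mul_single, AlgEquiv.smul_def, sigma_inv_ratVar, h]
      by_cases hij : i = j
      · subst hij; rfl
      · simp [hij, Ne.symm hij, mul_comm])
    (fun i j => by
      have h : (sigma k n i)⁻¹ * sigma k n j = sigma k n j * (sigma k n i)⁻¹ :=
        ((Commute.inv_left (sigma_comm k n i j)) : Commute _ _)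
      simp only [SkewMonoidAlgebra.single_mul_single, AlgEquiv.smul_def, sigma_ratVar, map_one, h,
        mul_one, one_mul]
      by_cases hij : i = j
      · subst hij
        simp [sub_eq_add_neg, ← SkewMonoidAlgebra.single_neg, ← SkewMonoidAlgebra.single_add]
      · simp [hij, Ne.symm hij])

end Weyl

end

/-!
Write `P = k[t_1, …, t_n]` and `L = k(t_1, …, t_n)`. The Weyl algebra is graded by `ℤ ^ n`, with
`x_i` of degree `e_i` and `∂_i` of degree `-e_i`, and the embedding sends the component of degree
`a` into `P σ^a`. Roots of unity act on it by a character of `a`, which is trivial for all of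
`G_m ^ n` exactly when `m ∣ a`; so invariance under `G_m ^ n` means support in `ℳ_m`, and the
invariants of `G_m ^ n ⋊ H` are `A_n ∩ (L * ℳ_m)^H`.

The image `A` of the Weyl algebra contains `P` and a nonzero multiple of each shift, and its
elements have all their coefficients in `P`. These properties alone give the theorem for the
invariants under a finite group `G` preserving `P`: coefficients in `P`, which is finite over
the Noetherian ring `P^G`, bound both `Γ u Γ` and `V ∩ U`, while every element of `(L * ℳ)^G` is
multiplied into `A`, from either side, by a nonzero element of `P^G` (a norm of a common denominator
of its coefficients relative to multiples of shifts lying in `A`), so that `K U = U K = (L * ℳ)^G`.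
Finite generation of the algebra of invariants holds because the Weyl algebra is finite over the
pair of commuting actions, from the left and from the right, of symmetric polynomials in `x_i ^ m`
and in `∂_i ^ m`, which are invariant.
-/

noncomputable section

/-! ### Finite generation over subalgebras -/

section FiniteGeneration

variable {k A : Type*} [Field k] [Ring A] [Algebra k A]

theorem restrictScalars_span_left (R : Subalgebra k A) (T : Set A) :
    (Submodule.span R T).restrictScalars k = Subalgebra.toSubmodule R * Submodule.span k T := by
  apply le_antisymm
  · intro v hv
    induction hv using Submodule.span_induction with
    | mem t ht =>
      rw [← one_mul t]
      exact Submodule.mul_mem_mul (one_mem R) (Submodule.subset_span ht)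
    | zero => exact zero_mem _
    | add v w _ _ hv hw => exact add_mem hv hw
    | smul r v _ hv =>
      rw [← R.isIdempotentElem_toSubmodule.eq, mul_assoc]
      exact Submodule.mul_mem_mul r.2 hv
  · refine Submodule.mul_le.2 fun r hr v hv => (Submodule.span R T).smul_mem ⟨r, hr⟩ ?_
    exact Submodule.span_le_restrictScalars k R T hv

theorem restrictScalars_span_right (R : Subalgebra k A) (T : Set A) :
    (Submodule.span R.op T).restrictScalars k =
      Submodule.span k T * Subalgebra.toSubmodule R := by
  apply le_antisymm
  · intro v hv
    induction hv using Submodule.span_induction with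
    | mem t ht =>
      rw [← mul_one t]
      exact Submodule.mul_mem_mul (Submodule.subset_span ht) (one_mem R)
    | zero => exact zero_mem _
    | add v w _ _ hv hw => exact add_mem hv hw
    | smul r v _ hv =>
      rw [← R.isIdempotentElem_toSubmodule.eq, ← mul_assoc]
      exact Submodule.mul_mem_mul hv r.2
  · refine Submodule.mul_le.2 fun v hv r hr =>
      (Submodule.span R.op T).smul_mem ⟨MulOpposite.op r, hr⟩ ?_
    exact Submodule.span_le_restrictScalars k R.op T hv

theorem leftFG_iff_exists_fg {R : Subalgebra k A} {V : Submodule k A} :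
    LeftFG R V ↔ ∃ W : Submodule R A, W.FG ∧ W.restrictScalars k = V := by
  constructor
  · rintro ⟨T, rfl⟩
    exact ⟨Submodule.span R T, ⟨T, rfl⟩, restrictScalars_span_left R T⟩
  · rintro ⟨_, ⟨T, rfl⟩, rfl⟩
    exact ⟨T, restrictScalars_span_left R T⟩

theorem rightFG_iff_exists_fg {R : Subalgebra k A} {V : Submodule k A} :
    RightFG R V ↔ ∃ W : Submodule R.op A, W.FG ∧ W.restrictScalars k = V := by
  constructor
  · rintro ⟨T, rfl⟩
    exact ⟨Submodule.span R.op T, ⟨T, rfl⟩, restrictScalars_span_right R T⟩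
  · rintro ⟨_, ⟨T, rfl⟩, rfl⟩
    exact ⟨T, restrictScalars_span_right R T⟩

theorem LeftFG.of_le {R : Subalgebra k A} [IsNoetherianRing R] {N V : Submodule k A}
    (hN : LeftFG R N) (hVN : V ≤ N) (hV : Subalgebra.toSubmodule R * V ≤ V) : LeftFG R V := by
  obtain ⟨N, hNfg, rfl⟩ := leftFG_iff_exists_fg.1 hN
  let W : Submodule R A :=
    { V with smul_mem' := fun r v hv => hV (Submodule.mul_mem_mul r.2 hv) }
  exact leftFG_iff_exists_fg.2
    ⟨W, isNoetherian_submodule.1 (isNoetherian_of_fg_of_noetherian N hNfg) W hVN, rfl⟩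

theorem RightFG.of_le {R : Subalgebra k A} [IsNoetherianRing R.op] {N V : Submodule k A}
    (hN : RightFG R N) (hVN : V ≤ N) (hV : V * Subalgebra.toSubmodule R ≤ V) : RightFG R V := by
  obtain ⟨N, hNfg, rfl⟩ := rightFG_iff_exists_fg.1 hN
  let W : Submodule R.op A :=
    { V with smul_mem' := fun r v hv => hV (Submodule.mul_mem_mul hv r.2) }
  exact rightFG_iff_exists_fg.2
    ⟨W, isNoetherian_submodule.1 (isNoetherian_of_fg_of_noetherian N hNfg) W hVN, rfl⟩

open scoped Pointwise in
theorem LeftFG.trans {R : Subalgebra k A} {P : Submodule k A} (hP : LeftFG R P) (T : Finset A) :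
    LeftFG R (P * Submodule.span k (T : Set A)) := by
  classical
  obtain ⟨S, rfl⟩ := hP
  exact ⟨S * T, by rw [Finset.coe_mul, ← Submodule.span_mul_span, mul_assoc]⟩

open scoped Pointwise in
theorem RightFG.trans {R : Subalgebra k A} {P : Submodule k A} (hP : RightFG R P) (T : Finset A) :
    RightFG R (Submodule.span k (T : Set A) * P) := by
  classical
  obtain ⟨S, rfl⟩ := hP
  exact ⟨T * S, by rw [Finset.coe_mul, ← Submodule.span_mul_span, mul_assoc]⟩

section Map

variable {B : Type*} [Ring B] [Algebra k B] {R : Subalgebra k A} {V : Submodule k A}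

theorem LeftFG.map (h : LeftFG R V) (f : A →ₐ[k] B) : LeftFG (R.map f) (V.map f.toLinearMap) := by
  classical
  obtain ⟨T, rfl⟩ := h
  refine ⟨T.image f, ?_⟩
  rw [Submodule.map_mul, Submodule.map_span, Finset.coe_image, Subalgebra.map_toSubmodule]
  rfl

theorem RightFG.map (h : RightFG R V) (f : A →ₐ[k] B) :
    RightFG (R.map f) (V.map f.toLinearMap) := by
  classical
  obtain ⟨T, rfl⟩ := h
  refine ⟨T.image f, ?_⟩
  rw [Submodule.map_mul, Submodule.map_span, Finset.coe_image, Subalgebra.map_toSubmodule]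
  rfl

theorem exists_finset_coe_image_eq {f : A →ₐ[k] B} {T : Finset B}
    (hT : (T : Set B) ⊆ V.map f.toLinearMap) : ∃ T' : Finset A, f '' T' = T := by
  classical
  obtain ⟨T', -, rfl⟩ := Finset.subset_set_image_iff.1 hT
  exact ⟨T', (Finset.coe_image ..).symm⟩

theorem LeftFG.of_map {f : A →ₐ[k] B} (hf : Function.Injective f)
    (h : LeftFG (R.map f) (V.map f.toLinearMap)) : LeftFG R V := by
  obtain ⟨T, hT⟩ := h
  obtain ⟨T', hT'⟩ := exists_finset_coe_image_eq (V := V) (f := f) (T := T) fun t ht => by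
    rw [hT, ← one_mul t]
    exact Submodule.mul_mem_mul (one_mem (R.map f)) (Submodule.subset_span ht)
  refine ⟨T', Submodule.map_injective_of_injective (f := f.toLinearMap) hf ?_⟩
  rw [hT, ← hT', Submodule.map_mul, Submodule.map_span, Subalgebra.map_toSubmodule]
  rfl

theorem RightFG.of_map {f : A →ₐ[k] B} (hf : Function.Injective f)
    (h : RightFG (R.map f) (V.map f.toLinearMap)) : RightFG R V := by
  obtain ⟨T, hT⟩ := h
  obtain ⟨T', hT'⟩ := exists_finset_coe_image_eq (V := V) (f := f) (T := T) fun t ht => by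
    rw [hT, ← mul_one t]
    exact Submodule.mul_mem_mul (Submodule.subset_span ht) (one_mem (R.map f))
  refine ⟨T', Submodule.map_injective_of_injective (f := f.toLinearMap) hf ?_⟩
  rw [hT, ← hT', Submodule.map_mul, Submodule.map_span, Subalgebra.map_toSubmodule]
  rfl

theorem IsHarishChandra.of_map {Γ U : Subalgebra k A} {f : A →ₐ[k] B}
    (hf : Function.Injective f) (h : IsHarishChandra (Γ.map f) (U.map f)) :
    IsHarishChandra Γ U := by
  have map_bimodule (u : A) :
      (Subalgebra.toSubmodule Γ * Submodule.span k {u} * Subalgebra.toSubmodule Γ).map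
        f.toLinearMap = Subalgebra.toSubmodule (Γ.map f) * Submodule.span k {f u} *
          Subalgebra.toSubmodule (Γ.map f) := by
    rw [Submodule.map_mul, Submodule.map_mul, Submodule.map_span, Set.image_singleton,
      Subalgebra.map_toSubmodule]
    rfl
  refine ⟨fun a ha => ?_, fun a ha b hb => hf ?_, fun u hu => ?_, fun u hu => ?_⟩
  · obtain ⟨b, hb, hba⟩ := h.le ⟨a, ha, rfl⟩
    exact hf hba ▸ hb
  · rw [map_mul, map_mul]
    exact h.comm _ ⟨a, ha, rfl⟩ _ ⟨b, hb, rfl⟩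
  · exact .of_map hf (map_bimodule u ▸ h.left _ ⟨u, hu, rfl⟩)
  · exact .of_map hf (map_bimodule u ▸ h.right _ ⟨u, hu, rfl⟩)

end Map

section Commutative

variable {Q : Type*} [CommRing Q] [Algebra k Q] (S : Subalgebra k Q)

theorem leftFG_top [Module.Finite S Q] : LeftFG S ⊤ :=
  leftFG_iff_exists_fg.2 ⟨⊤, Module.Finite.fg_top, Submodule.restrictScalars_top ..⟩

theorem rightFG_top [Module.Finite S Q] : RightFG S ⊤ := by
  obtain ⟨T, hT⟩ := leftFG_top S
  exact ⟨T, by rw [hT, mul_comm]⟩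

instance isNoetherianRing_map (f : Q →ₐ[k] A) [IsNoetherianRing S] : IsNoetherianRing (S.map f) :=
  isNoetherianRing_of_surjective S (S.map f) ((f.comp S.val).codRestrict (S.map f)
    fun s => ⟨s, s.2, rfl⟩) (by rintro ⟨_, s, hs, rfl⟩; exact ⟨⟨s, hs⟩, rfl⟩)

instance isNoetherianRing_op_map (f : Q →ₐ[k] A)
    [IsNoetherianRing S] : IsNoetherianRing (S.map f).op :=
  isNoetherianRing_of_surjective S (S.map f).op
    (((f.comp S.val).toOpposite fun _ _ => (Commute.all _ _).map _).codRestrict (S.map f).op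
      fun s => ⟨s, s.2, rfl⟩)
    (by rintro ⟨r, s, hs, hr⟩; exact ⟨⟨s, hs⟩, Subtype.ext (MulOpposite.unop_injective hr)⟩)

theorem isNoetherianRing_of_isIntegral [Algebra.FiniteType k Q] [Algebra.IsIntegral S Q] :
    IsNoetherianRing S := by
  have : Algebra.FiniteType S Q := .of_restrictScalars_finiteType k S Q
  exact isNoetherianRing_of_fg <| S.fg_top.1 <| fg_of_fg_of_fg k S Q Algebra.FiniteType.out
    Algebra.IsIntegral.finite.fg_top Subtype.val_injective

end Commutative

end FiniteGeneration

/-! ### Skew group rings -/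

section FixedSubalgebra

open Pointwise

variable {k L : Type*} [Field k] [Field L] [Algebra k L]

/-- The group of the automorphisms of `L` over `k` that map the subalgebra `P` onto itself. -/
def autStabilizer (P : Subalgebra k L) : Subgroup (L ≃ₐ[k] L) :=
  MulAction.stabilizer (L ≃ₐ[k] L) P.toSubring

theorem apply_mem_of_mem_autStabilizer {P : Subalgebra k L} {g : L ≃ₐ[k] L}
    (hg : g ∈ autStabilizer P) {l : L} (hl : l ∈ P) : g l ∈ P := by
  have h := Subring.smul_mem_pointwise_smul g l P.toSubring hl
  rwa [MulAction.mem_stabilizer_iff.1 hg] at h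

theorem finiteDimensional_fixedField (G : Subgroup (L ≃ₐ[k] L)) [Finite G] :
    FiniteDimensional (IntermediateField.fixedField G) L :=
  inferInstanceAs (FiniteDimensional (FixedPoints.subfield G L) L)

theorem fixingSubgroup_fixedField_of_finite (G : Subgroup (L ≃ₐ[k] L)) [Finite G] :
    (IntermediateField.fixedField G).fixingSubgroup = G := by
  refine le_antisymm (fun g hg => ?_) ((IntermediateField.le_iff_le _ _).mp le_rfl)
  obtain ⟨h, hh⟩ := FixedPoints.toAlgAut_surjective G L
    (IntermediateField.fixingSubgroupEquiv (IntermediateField.fixedField G) ⟨g, hg⟩)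
  have h_eq : (h : L ≃ₐ[k] L) = g := AlgEquiv.ext fun l => DFunLike.congr_fun hh l
  exact h_eq ▸ h.2

variable (P : Subalgebra k L) (G : Subgroup (L ≃ₐ[k] L))

/-- The invariant subalgebra `P^G` of a subalgebra `P` of `L`. -/
def fixedSubalgebra : Subalgebra k L := P ⊓ (IntermediateField.fixedField G).toSubalgebra

variable {P G}

theorem mem_fixedSubalgebra {l : L} : l ∈ fixedSubalgebra P G ↔ l ∈ P ∧ ∀ g ∈ G, g l = l :=
  and_congr_right fun _ => IntermediateField.mem_fixedField_iff G l

theorem map_comap_fixedField :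
    ((IntermediateField.fixedField G).toSubalgebra.comap P.val).map P.val =
      fixedSubalgebra P G := by
  rw [Subalgebra.map_comap_eq, P.range_val, inf_comm, fixedSubalgebra]

variable [Finite G] (hG : G ≤ autStabilizer P)
include hG

theorem isIntegral_comap_fixedField :
    Algebra.IsIntegral ((IntermediateField.fixedField G).toSubalgebra.comap P.val) P := by
  have : IsInvariantSubring G P.toSubring :=
    ⟨fun g _ hl => apply_mem_of_mem_autStabilizer (hG g.2) hl⟩
  let _ : MulSemiringAction G P := inferInstanceAs (MulSemiringAction G P.toSubring)
  have : Algebra.IsInvariant ((IntermediateField.fixedField G).toSubalgebra.comap P.val) P G :=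
    ⟨fun p hp => ⟨⟨p, (IntermediateField.mem_fixedField_iff G _).2 fun g hg =>
      congrArg Subtype.val (hp ⟨g, hg⟩)⟩, rfl⟩⟩
  exact Algebra.IsInvariant.isIntegral _ P G

theorem exists_mul_mem_fixedSubalgebra {q : L} (hq : q ∈ P) (hq0 : q ≠ 0) :
    ∃ p ∈ P, p ≠ 0 ∧ p * q ∈ fixedSubalgebra P G := by
  classical
  cases nonempty_fintype G
  have hgq (g : G) : g.1 q ∈ P := apply_mem_of_mem_autStabilizer (hG g.2) hq
  have norm_eq : ∏ g : G, g.1 q = (∏ g ∈ Finset.univ.erase (1 : G), g.1 q) * q :=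
    (Finset.prod_erase_mul _ _ (Finset.mem_univ 1)).symm
  refine ⟨∏ g ∈ Finset.univ.erase (1 : G), g.1 q, prod_mem fun g _ => hgq g,
    Finset.prod_ne_zero_iff.2 fun g _ => by simpa using hq0, ?_⟩
  rw [← norm_eq, mem_fixedSubalgebra]
  refine ⟨prod_mem fun g _ => hgq g, fun h hh => ?_⟩
  rw [map_prod]
  exact Fintype.prod_equiv (Equiv.mulLeft ⟨h, hh⟩) _ _ fun g => rfl

variable [IsFractionRing P L]

theorem exists_mem_fixedSubalgebra_apply_mul_mem {g : L ≃ₐ[k] L}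
    (hg : g ∈ autStabilizer P) (l : L) :
    ∃ q ∈ fixedSubalgebra P G, q ≠ 0 ∧ g q * l ∈ P := by
  obtain ⟨a, b, hb, rfl⟩ := IsFractionRing.div_surjective (A := P) l
  have hb0 : (b : L) ≠ 0 := by simpa using nonZeroDivisors.ne_zero hb
  obtain ⟨p, hp, hp0, hpb⟩ := exists_mul_mem_fixedSubalgebra hG
    (apply_mem_of_mem_autStabilizer (inv_mem hg) b.2) (by simpa using hb0 : g⁻¹ (b : L) ≠ 0)
  refine ⟨p * g⁻¹ b, hpb, mul_ne_zero hp0 (by simpa using hb0), ?_⟩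
  have h_eq : g (p * g⁻¹ b) * (algebraMap P L a / algebraMap P L b) = g p * a := by
    have : g (g⁻¹ b) = (b : L) := g.apply_symm_apply b
    rw [map_mul, this]
    change g p * b * (a / b : L) = _
    field_simp
  rw [h_eq]
  exact mul_mem (apply_mem_of_mem_autStabilizer hg hp) a.2

theorem adjoin_fixedSubalgebra :
    IntermediateField.adjoin k (fixedSubalgebra P G : Set L) =
      IntermediateField.fixedField G := by
  refine le_antisymm (IntermediateField.adjoin_le_iff.2 fun l hl => hl.2) fun l hl => ?_
  obtain ⟨q, hq, hq0, hql⟩ := exists_mem_fixedSubalgebra_apply_mul_mem hG (one_mem _) l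
  have hql_fixed : q * l ∈ fixedSubalgebra P G :=
    ⟨hql, mul_mem hq.2 hl⟩
  rw [← mul_div_cancel_left₀ l hq0]
  exact div_mem (IntermediateField.subset_adjoin _ _ hql_fixed)
    (IntermediateField.subset_adjoin _ _ hq)

end FixedSubalgebra

section SkewRing

open SkewMonoidAlgebra

variable {k L : Type*} [Field k] [Field L] [Algebra k L]

theorem skewCoeff_apply (l : L) : skewCoeff k L l = single 1 l := rfl

theorem skewCoeff_injective : Function.Injective (skewCoeff k L) := single_injective 1

theorem skewCoeff_mul_single (l c : L) (g : L ≃ₐ[k] L) :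
    skewCoeff k L l * single g c = single g (l * c) := by
  simp [skewCoeff_apply]

theorem single_mul_skewCoeff (l c : L) (g : L ≃ₐ[k] L) :
    single g c * skewCoeff k L l = single g (c * g l) := by
  simp [skewCoeff_apply]

theorem skewConj_skewCoeff (g : L ≃ₐ[k] L) (l : L) :
    skewConj g (skewCoeff k L l) = skewCoeff k L (g l) := by
  rw [skewCoeff_apply, skewConj_single, mul_one, mul_inv_cancel, skewCoeff_apply]

theorem eq_sum_single (y : SkewAut k L) : y = ∑ g ∈ y.support, single g (y.coeff g) :=
  (sum_single y).symm

theorem mem_invSkewMonoidRing {M : Submonoid (L ≃ₐ[k] L)} {G : Subgroup (L ≃ₐ[k] L)}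
    {y : SkewAut k L} :
    y ∈ invSkewMonoidRing M G ↔ y ∈ skewMonoidRing M ∧ ∀ g ∈ G, skewConj g y = y := by
  simp [invSkewMonoidRing, Algebra.mem_inf, Algebra.mem_iInf, AlgHom.mem_equalizer]

theorem single_mem_skewMonoidRing {M : Submonoid (L ≃ₐ[k] L)} {g : L ≃ₐ[k] L} (hg : g ∈ M)
    (c : L) : single g c ∈ skewMonoidRing M := fun _ hh =>
  Finset.mem_singleton.1 (support_single_subset hh) ▸ hg

theorem skewCoeff_mem_invSkewMonoidRing {M : Submonoid (L ≃ₐ[k] L)} {G : Subgroup (L ≃ₐ[k] L)}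
    {l : L} : skewCoeff k L l ∈ invSkewMonoidRing M G ↔ ∀ g ∈ G, g l = l := by
  have h_mem : skewCoeff k L l ∈ skewMonoidRing M := single_mem_skewMonoidRing M.one_mem l
  simp only [mem_invSkewMonoidRing, h_mem, true_and, skewConj_skewCoeff,
    skewCoeff_injective.eq_iff]

theorem map_fixedSubalgebra (P : Subalgebra k L) (M : Submonoid (L ≃ₐ[k] L))
    (G : Subgroup (L ≃ₐ[k] L)) :
    (fixedSubalgebra P G).map (skewCoeff k L) =
      P.map (skewCoeff k L) ⊓ invSkewMonoidRing M G := by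
  ext y
  constructor
  · rintro ⟨l, hl, rfl⟩
    obtain ⟨hlP, hlG⟩ := mem_fixedSubalgebra.1 hl
    exact ⟨⟨l, hlP, rfl⟩, skewCoeff_mem_invSkewMonoidRing.2 hlG⟩
  · rintro ⟨⟨l, hl, rfl⟩, h⟩
    exact ⟨l, mem_fixedSubalgebra.2 ⟨hl, skewCoeff_mem_invSkewMonoidRing.1 h⟩, rfl⟩

/-- The elements of the skew group ring supported on `F`, a finite-dimensional left and right
`L`-subspace. -/
def supportedOn (F : Finset (L ≃ₐ[k] L)) : Submodule k (SkewAut k L) where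
  carrier := {x | x.support ⊆ F}
  zero_mem' := by simp
  add_mem' := by
    classical
    exact fun ha hb => support_add.trans (Finset.union_subset ha hb)
  smul_mem' c x hx := fun g hg => hx (by
    rw [mem_support_iff] at hg ⊢
    exact fun h => hg (by rw [coeff_smul, Finsupp.smul_apply, h, smul_zero]))

theorem range_skewCoeff_mul_supportedOn_le (F : Finset (L ≃ₐ[k] L)) :
    Subalgebra.toSubmodule (skewCoeff k L).range * supportedOn F ≤ supportedOn F := by
  refine Submodule.mul_le.2 ?_
  rintro _ ⟨l, rfl⟩ y hy g hg
  refine hy (mem_support_iff.2 fun h => mem_support_iff.1 hg ?_)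
  change (single 1 l * y).coeff g = 0
  rw [coeff_single_one_mul, h, mul_zero]

theorem supportedOn_mul_range_skewCoeff_le (F : Finset (L ≃ₐ[k] L)) :
    supportedOn F * Subalgebra.toSubmodule (skewCoeff k L).range ≤ supportedOn F := by
  refine Submodule.mul_le.2 ?_
  rintro y hy _ ⟨l, rfl⟩ g hg
  refine hy (mem_support_iff.2 fun h => mem_support_iff.1 hg ?_)
  change (y * single 1 l).coeff g = 0
  rw [coeff_mul_single_one, h, zero_mul]

theorem exists_span_le_supportedOn (T : Finset (SkewAut k L)) :
    ∃ F : Finset (L ≃ₐ[k] L), Submodule.span k (T : Set (SkewAut k L)) ≤ supportedOn F := by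
  classical
  exact ⟨T.biUnion support, Submodule.span_le.2 fun t ht => Finset.subset_biUnion_of_mem _ ht⟩

end SkewRing

/-! ### Galois orders from skew orders -/

section SkewOrder

open SkewMonoidAlgebra

variable {k L : Type*} [Field k] [Field L] [Algebra k L] {P : Subalgebra k L}

theorem mem_mul_span_single {F : Finset (L ≃ₐ[k] L)} [DecidableEq (SkewAut k L)]
    {y : SkewAut k L} (hy : y ∈ supportedOn F) (hyP : ∀ g, y.coeff g ∈ P) :
    y ∈ Subalgebra.toSubmodule (P.map (skewCoeff k L)) *
      Submodule.span k (F.image fun g => single g (1 : L) : Finset (SkewAut k L)) := by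
  rw [eq_sum_single y]
  refine sum_mem fun g hg => ?_
  rw [← mul_one (y.coeff g), ← skewCoeff_mul_single]
  exact Submodule.mul_mem_mul ⟨_, hyP g, rfl⟩
    (Submodule.subset_span (Finset.mem_image_of_mem _ (hy hg)))

theorem mem_span_single_mul {F : Finset (L ≃ₐ[k] L)} [DecidableEq (SkewAut k L)]
    {y : SkewAut k L} (hy : y ∈ supportedOn F) (hyP : ∀ g, y.coeff g ∈ P)
    (hyM : y ∈ skewMonoidRing (autStabilizer P).toSubmonoid) :
    y ∈ Submodule.span k (F.image fun g => single g (1 : L) : Finset (SkewAut k L)) *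
      Subalgebra.toSubmodule (P.map (skewCoeff k L)) := by
  rw [eq_sum_single y]
  refine sum_mem fun g hg => ?_
  have h_eq : single g (y.coeff g) = single g 1 * skewCoeff k L (g⁻¹ (y.coeff g)) := by
    rw [single_mul_skewCoeff, one_mul]
    exact congrArg _ (g.apply_symm_apply _).symm
  rw [h_eq]
  exact Submodule.mul_mem_mul (Submodule.subset_span (Finset.mem_image_of_mem _ (hy hg)))
    ⟨_, apply_mem_of_mem_autStabilizer (inv_mem (hyM g hg)) (hyP g), rfl⟩

variable {G : Subgroup (L ≃ₐ[k] L)}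

theorem fracField_map_fixedSubalgebra [Finite G] [IsFractionRing P L] (hG : G ≤ autStabilizer P) :
    fracField ((fixedSubalgebra P G).map (skewCoeff k L)) = IntermediateField.fixedField G := by
  rw [← adjoin_fixedSubalgebra hG, fracField]
  congr 1
  ext l
  exact skewCoeff_injective.mem_set_image

theorem le_fracAlg {Γ : Subalgebra k (SkewAut k L)} (hΓ : Γ ≤ (skewCoeff k L).range) :
    Γ ≤ fracAlg Γ := by
  intro y hy
  obtain ⟨l, rfl⟩ := hΓ hy
  exact ⟨l, IntermediateField.subset_adjoin _ _ hy, rfl⟩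

theorem fracAlg_le_range (Γ : Subalgebra k (SkewAut k L)) : fracAlg Γ ≤ (skewCoeff k L).range :=
  Subalgebra.map_le.2 fun l _ => ⟨l, rfl⟩

theorem map_skewCoeff_le_range (S : Subalgebra k L) :
    S.map (skewCoeff k L) ≤ (skewCoeff k L).range :=
  Subalgebra.map_le.2 fun l _ => ⟨l, rfl⟩

section FiniteType

variable [Finite G] [Algebra.FiniteType k P] (hG : G ≤ autStabilizer P)
include hG

theorem isNoetherianRing_fixedSubalgebra : IsNoetherianRing (fixedSubalgebra P G) := by
  have := isIntegral_comap_fixedField hG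
  have := isNoetherianRing_of_isIntegral
    ((IntermediateField.fixedField G).toSubalgebra.comap P.val)
  rw [← map_comap_fixedField]
  infer_instance

theorem finite_comap_fixedField :
    Module.Finite ((IntermediateField.fixedField G).toSubalgebra.comap P.val) P := by
  have := isIntegral_comap_fixedField hG
  have : Algebra.FiniteType ((IntermediateField.fixedField G).toSubalgebra.comap P.val) P :=
    .of_restrictScalars_finiteType k _ _
  exact Algebra.IsIntegral.finite

theorem leftFG_fixedSubalgebra :
    LeftFG ((fixedSubalgebra P G).map (skewCoeff k L))
      (Subalgebra.toSubmodule (P.map (skewCoeff k L))) := by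
  have := finite_comap_fixedField hG
  have h := ((leftFG_top ((IntermediateField.fixedField G).toSubalgebra.comap P.val)).map
    P.val).map (skewCoeff k L)
  rwa [map_comap_fixedField, ← Algebra.top_toSubmodule, ← Subalgebra.map_toSubmodule,
    Algebra.map_top, P.range_val, ← Subalgebra.map_toSubmodule] at h

theorem rightFG_fixedSubalgebra :
    RightFG ((fixedSubalgebra P G).map (skewCoeff k L))
      (Subalgebra.toSubmodule (P.map (skewCoeff k L))) := by
  have := finite_comap_fixedField hG
  have h := ((rightFG_top ((IntermediateField.fixedField G).toSubalgebra.comap P.val)).map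
    P.val).map (skewCoeff k L)
  rwa [map_comap_fixedField, ← Algebra.top_toSubmodule, ← Subalgebra.map_toSubmodule,
    Algebra.map_top, P.range_val, ← Subalgebra.map_toSubmodule] at h

variable {F : Finset (L ≃ₐ[k] L)} {V : Submodule k (SkewAut k L)}

theorem leftFG_of_le_supportedOn (hVF : V ≤ supportedOn F) (hVP : ∀ y ∈ V, ∀ g, y.coeff g ∈ P)
    (hV : Subalgebra.toSubmodule ((fixedSubalgebra P G).map (skewCoeff k L)) * V ≤ V) :
    LeftFG ((fixedSubalgebra P G).map (skewCoeff k L)) V := by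
  classical
  have := isNoetherianRing_fixedSubalgebra hG
  exact ((leftFG_fixedSubalgebra hG).trans _).of_le
    (fun y hy => mem_mul_span_single (hVF hy) (hVP y hy)) hV

theorem rightFG_of_le_supportedOn (hVF : V ≤ supportedOn F) (hVP : ∀ y ∈ V, ∀ g, y.coeff g ∈ P)
    (hVM : V ≤ Subalgebra.toSubmodule (skewMonoidRing (autStabilizer P).toSubmonoid))
    (hV : V * Subalgebra.toSubmodule ((fixedSubalgebra P G).map (skewCoeff k L)) ≤ V) :
    RightFG ((fixedSubalgebra P G).map (skewCoeff k L)) V := by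
  classical
  have := isNoetherianRing_fixedSubalgebra hG
  exact ((rightFG_fixedSubalgebra hG).trans _).of_le
    (fun y hy => mem_span_single_mul (hVF hy) (hVP y hy) (hVM hy)) hV

end FiniteType

/-- An order over `P` in the skew monoid ring `L * M`: a subalgebra containing `P`, whose elements
have all their coefficients in `P`, and which contains a nonzero multiple of each element of `M`. -/
structure IsSkewOrder (P : Subalgebra k L) (M : Submonoid (L ≃ₐ[k] L))
    (A : Subalgebra k (SkewAut k L)) : Prop where
  coeff_mem : ∀ y ∈ A, ∀ g, y.coeff g ∈ P
  map_le : P.map (skewCoeff k L) ≤ A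
  exists_single_mem : ∀ g ∈ M, ∃ c ≠ 0, single g c ∈ A

namespace IsSkewOrder

variable {M : Submonoid (L ≃ₐ[k] L)} {A : Subalgebra k (SkewAut k L)} (hA : IsSkewOrder P M A)
include hA

theorem skewCoeff_mem {p : L} (hp : p ∈ fixedSubalgebra P G) : skewCoeff k L p ∈ A :=
  hA.map_le ⟨p, hp.1, rfl⟩

theorem map_fixedSubalgebra_le :
    (fixedSubalgebra P G).map (skewCoeff k L) ≤ A ⊓ invSkewMonoidRing M G := by
  rw [map_fixedSubalgebra P M G]
  exact inf_le_inf_right _ hA.map_le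

section Denominators

variable [Finite G] [IsFractionRing P L] (hG : G ≤ autStabilizer P)
include hG

theorem exists_skewCoeff_mul_mem {y : SkewAut k L} (hy : y ∈ skewMonoidRing M) :
    ∃ q ∈ fixedSubalgebra P G, q ≠ 0 ∧ skewCoeff k L q * y ∈ A := by
  rw [eq_sum_single y]
  refine Finset.sum_induction _
    (fun y => ∃ q ∈ fixedSubalgebra P G, q ≠ 0 ∧ skewCoeff k L q * y ∈ A) ?_ ?_ ?_
  · rintro a b ⟨p, hp, hp0, hpa⟩ ⟨q, hq, hq0, hqb⟩
    refine ⟨p * q, mul_mem hp hq, mul_ne_zero hp0 hq0, ?_⟩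
    rw [mul_add]
    refine add_mem ?_ ?_
    · rw [mul_comm p, map_mul, mul_assoc]
      exact mul_mem (hA.skewCoeff_mem hq) hpa
    · rw [map_mul, mul_assoc]
      exact mul_mem (hA.skewCoeff_mem hp) hqb
  · exact ⟨1, one_mem _, one_ne_zero, by simp⟩
  · intro g hg
    obtain ⟨c, hc0, hc⟩ := hA.exists_single_mem g (hy g hg)
    obtain ⟨q, hq, hq0, hqP⟩ :=
      exists_mem_fixedSubalgebra_apply_mul_mem hG (one_mem _) (y.coeff g / c)
    refine ⟨q, hq, hq0, ?_⟩
    have h_eq : skewCoeff k L q * single g (y.coeff g) =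
        skewCoeff k L (q * (y.coeff g / c)) * single g c := by
      rw [skewCoeff_mul_single, skewCoeff_mul_single, mul_assoc, div_mul_cancel₀ _ hc0]
    rw [h_eq]
    exact mul_mem (hA.map_le ⟨_, hqP, rfl⟩) hc

theorem exists_mul_skewCoeff_mem (hM : M ≤ (autStabilizer P).toSubmonoid) {y : SkewAut k L}
    (hy : y ∈ skewMonoidRing M) :
    ∃ q ∈ fixedSubalgebra P G, q ≠ 0 ∧ y * skewCoeff k L q ∈ A := by
  rw [eq_sum_single y]
  refine Finset.sum_induction _
    (fun y => ∃ q ∈ fixedSubalgebra P G, q ≠ 0 ∧ y * skewCoeff k L q ∈ A) ?_ ?_ ?_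
  · rintro a b ⟨p, hp, hp0, hpa⟩ ⟨q, hq, hq0, hqb⟩
    refine ⟨p * q, mul_mem hp hq, mul_ne_zero hp0 hq0, ?_⟩
    rw [add_mul]
    refine add_mem ?_ ?_
    · rw [map_mul, ← mul_assoc]
      exact mul_mem hpa (hA.skewCoeff_mem hq)
    · rw [mul_comm p, map_mul, ← mul_assoc]
      exact mul_mem hqb (hA.skewCoeff_mem hp)
  · exact ⟨1, one_mem _, one_ne_zero, by simp⟩
  · intro g hg
    obtain ⟨c, hc0, hc⟩ := hA.exists_single_mem g (hy g hg)
    obtain ⟨q, hq, hq0, hqP⟩ :=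
      exists_mem_fixedSubalgebra_apply_mul_mem hG (hM (hy g hg)) (y.coeff g / c)
    refine ⟨q, hq, hq0, ?_⟩
    have h_eq : single g (y.coeff g) * skewCoeff k L q =
        skewCoeff k L (g q * (y.coeff g / c)) * single g c := by
      rw [single_mul_skewCoeff, skewCoeff_mul_single, mul_assoc, div_mul_cancel₀ _ hc0, mul_comm]
    rw [h_eq]
    exact mul_mem (hA.map_le ⟨_, hqP, rfl⟩) hc

theorem fracAlg_mul_eq :
    Subalgebra.toSubmodule (fracAlg ((fixedSubalgebra P G).map (skewCoeff k L))) *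
      Subalgebra.toSubmodule (A ⊓ invSkewMonoidRing M G) =
    Subalgebra.toSubmodule (invSkewMonoidRing M G) := by
  rw [fracAlg, fracField_map_fixedSubalgebra hG]
  refine le_antisymm (Submodule.mul_le.2 ?_) fun y hy => ?_
  · rintro _ ⟨l, hl, rfl⟩ u hu
    exact (invSkewMonoidRing M G).mul_mem (skewCoeff_mem_invSkewMonoidRing.2
      ((IntermediateField.mem_fixedField_iff G l).1 hl)) hu.2
  · obtain ⟨q, hq, hq0, hqy⟩ := hA.exists_skewCoeff_mul_mem hG (mem_invSkewMonoidRing.1 hy).1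
    rw [← one_mul y, ← map_one (skewCoeff k L), ← inv_mul_cancel₀ hq0, map_mul, mul_assoc]
    exact Submodule.mul_mem_mul ⟨q⁻¹, IntermediateField.inv_mem _ hq.2, rfl⟩
      ⟨hqy, mul_mem (hA.map_fixedSubalgebra_le ⟨q, hq, rfl⟩).2 hy⟩

theorem mul_fracAlg_eq (hM : M ≤ (autStabilizer P).toSubmonoid) :
    Subalgebra.toSubmodule (A ⊓ invSkewMonoidRing M G) *
      Subalgebra.toSubmodule (fracAlg ((fixedSubalgebra P G).map (skewCoeff k L))) =
    Subalgebra.toSubmodule (invSkewMonoidRing M G) := by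
  rw [fracAlg, fracField_map_fixedSubalgebra hG]
  refine le_antisymm (Submodule.mul_le.2 ?_) fun y hy => ?_
  · rintro u hu _ ⟨l, hl, rfl⟩
    exact (invSkewMonoidRing M G).mul_mem hu.2 (skewCoeff_mem_invSkewMonoidRing.2
      ((IntermediateField.mem_fixedField_iff G l).1 hl))
  · obtain ⟨q, hq, hq0, hqy⟩ := hA.exists_mul_skewCoeff_mem hG hM (mem_invSkewMonoidRing.1 hy).1
    rw [← mul_one y, ← map_one (skewCoeff k L), ← mul_inv_cancel₀ hq0, map_mul, ← mul_assoc]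
    exact Submodule.mul_mem_mul
      ⟨hqy, mul_mem hy (hA.map_fixedSubalgebra_le ⟨q, hq, rfl⟩).2⟩
      ⟨q⁻¹, IntermediateField.inv_mem _ hq.2, rfl⟩

theorem isGaloisRing (hM : M ≤ (autStabilizer P).toSubmonoid)
    (hconj : ∀ g ∈ G, ∀ m ∈ M, g * m * g⁻¹ ∈ M)
    (hsep : ∀ m ∈ M, ∀ m' ∈ M, m⁻¹ * m' ∈ G → m = m')
    (hfg : (A ⊓ invSkewMonoidRing M G).FG) :
    IsGaloisRing M G ((fixedSubalgebra P G).map (skewCoeff k L))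
      (A ⊓ invSkewMonoidRing M G) where
  coeff := map_skewCoeff_le_range _
  finite := by
    rw [fracField_map_fixedSubalgebra hG]
    exact finiteDimensional_fixedField G
  galois := by
    rw [fracField_map_fixedSubalgebra hG]
    exact IsGalois.of_fixed_field L G
  group := by rw [fracField_map_fixedSubalgebra hG, fixingSubgroup_fixedField_of_finite]
  conj := hconj
  separating m hm m' hm' h := hsep m hm m' hm' <| by
    rw [fracField_map_fixedSubalgebra hG] at h
    rw [← fixingSubgroup_fixedField_of_finite G, IntermediateField.mem_fixingSubgroup_iff]
    intro c hc
    change m.symm (m' c) = c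
    rw [← h c hc, m.symm_apply_apply]
  base_le := hA.map_fixedSubalgebra_le
  le := inf_le_right
  fg := by
    obtain ⟨S, hS⟩ := hfg
    refine ⟨S, le_antisymm ?_ (Algebra.adjoin_le (Set.union_subset hA.map_fixedSubalgebra_le ?_))⟩
    · exact hS.ge.trans (Algebra.adjoin_mono Set.subset_union_right)
    · exact Algebra.subset_adjoin.trans hS.le
  left_span := hA.fracAlg_mul_eq hG
  right_span := hA.mul_fracAlg_eq hG hM

end Denominators

variable [Finite G] [Algebra.FiniteType k P] (hG : G ≤ autStabilizer P)
include hG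

theorem leftFG {F : Finset (L ≃ₐ[k] L)} {V : Submodule k (SkewAut k L)}
    (hVF : V ≤ supportedOn F)
    (hVA : V ≤ Subalgebra.toSubmodule (A ⊓ invSkewMonoidRing M G))
    (hV : Subalgebra.toSubmodule ((fixedSubalgebra P G).map (skewCoeff k L)) * V ≤ V) :
    LeftFG ((fixedSubalgebra P G).map (skewCoeff k L)) V :=
  leftFG_of_le_supportedOn hG hVF (fun y hy => hA.coeff_mem y (hVA hy).1) hV

theorem rightFG (hM : M ≤ (autStabilizer P).toSubmonoid) {F : Finset (L ≃ₐ[k] L)}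
    {V : Submodule k (SkewAut k L)} (hVF : V ≤ supportedOn F)
    (hVA : V ≤ Subalgebra.toSubmodule (A ⊓ invSkewMonoidRing M G))
    (hV : V * Subalgebra.toSubmodule ((fixedSubalgebra P G).map (skewCoeff k L)) ≤ V) :
    RightFG ((fixedSubalgebra P G).map (skewCoeff k L)) V :=
  rightFG_of_le_supportedOn hG hVF (fun y hy => hA.coeff_mem y (hVA hy).1)
    (fun _ hy g hg => hM ((mem_invSkewMonoidRing.1 (hVA hy).2).1 g hg)) hV

theorem isHarishChandra (hM : M ≤ (autStabilizer P).toSubmonoid) :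
    IsHarishChandra ((fixedSubalgebra P G).map (skewCoeff k L)) (A ⊓ invSkewMonoidRing M G) := by
  set Γ := (fixedSubalgebra P G).map (skewCoeff k L)
  have hΓ : Subalgebra.toSubmodule Γ ≤ Subalgebra.toSubmodule (skewCoeff k L).range :=
    map_skewCoeff_le_range _
  have hΓU : Γ ≤ A ⊓ invSkewMonoidRing M G := hA.map_fixedSubalgebra_le
  have bimodule_le_supportedOn (u : SkewAut k L) : Subalgebra.toSubmodule Γ *
      Submodule.span k {u} * Subalgebra.toSubmodule Γ ≤ supportedOn u.support := by
    have hu : Submodule.span k {u} ≤ supportedOn u.support :=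
      (Submodule.span_singleton_le_iff_mem _ _).2 (Finset.Subset.refl u.support)
    refine le_trans (mul_le_mul' ?_ hΓ) (supportedOn_mul_range_skewCoeff_le _)
    exact le_trans (mul_le_mul' hΓ hu) (range_skewCoeff_mul_supportedOn_le _)
  have bimodule_le {u : SkewAut k L} (hu : u ∈ A ⊓ invSkewMonoidRing M G) :
      Subalgebra.toSubmodule Γ * Submodule.span k {u} * Subalgebra.toSubmodule Γ ≤
        Subalgebra.toSubmodule (A ⊓ invSkewMonoidRing M G) := by
    set U := A ⊓ invSkewMonoidRing M G
    have hu' : Submodule.span k {u} ≤ Subalgebra.toSubmodule U :=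
      (Submodule.span_singleton_le_iff_mem _ _).2 hu
    calc _ ≤ Subalgebra.toSubmodule U * Subalgebra.toSubmodule U * Subalgebra.toSubmodule U :=
          mul_le_mul' (mul_le_mul' hΓU hu') hΓU
      _ = Subalgebra.toSubmodule U := by simp only [U.isIdempotentElem_toSubmodule.eq]
  refine ⟨hΓU, ?_, fun u hu => ?_, fun u hu => ?_⟩
  · rintro _ ⟨a, -, rfl⟩ _ ⟨b, -, rfl⟩
    exact ((Commute.all a b).map (skewCoeff k L)).eq
  · refine hA.leftFG hG (bimodule_le_supportedOn u) (bimodule_le hu) ?_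
    rw [← mul_assoc, ← mul_assoc, Γ.isIdempotentElem_toSubmodule.eq]
  · refine hA.rightFG hG hM (bimodule_le_supportedOn u) (bimodule_le hu) ?_
    rw [mul_assoc _ (Subalgebra.toSubmodule Γ), Γ.isIdempotentElem_toSubmodule.eq]

theorem leftFG_inf {V : Submodule k (SkewAut k L)}
    (hV : LeftFG (fracAlg ((fixedSubalgebra P G).map (skewCoeff k L))) V) :
    LeftFG ((fixedSubalgebra P G).map (skewCoeff k L))
      (V ⊓ Subalgebra.toSubmodule (A ⊓ invSkewMonoidRing M G)) := by
  obtain ⟨T, rfl⟩ := hV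
  set Γ := (fixedSubalgebra P G).map (skewCoeff k L)
  have hΓ : Subalgebra.toSubmodule Γ ≤ Subalgebra.toSubmodule (fracAlg Γ) :=
    le_fracAlg (map_skewCoeff_le_range _)
  have hK : Subalgebra.toSubmodule (fracAlg Γ) ≤ Subalgebra.toSubmodule (skewCoeff k L).range :=
    fracAlg_le_range Γ
  have hΓU : Subalgebra.toSubmodule Γ ≤ Subalgebra.toSubmodule (A ⊓ invSkewMonoidRing M G) :=
    hA.map_fixedSubalgebra_le
  obtain ⟨F, hF⟩ := exists_span_le_supportedOn T
  refine hA.leftFG hG (F := F) (inf_le_left.trans ?_) inf_le_right ?_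
  · exact (mul_le_mul' hK hF).trans (range_skewCoeff_mul_supportedOn_le F)
  · refine le_inf ((mul_le_mul' hΓ inf_le_left).trans ?_)
      ((mul_le_mul' hΓU inf_le_right).trans ?_)
    · rw [← mul_assoc, (fracAlg Γ).isIdempotentElem_toSubmodule.eq]
    · rw [Subalgebra.isIdempotentElem_toSubmodule]

theorem rightFG_inf (hM : M ≤ (autStabilizer P).toSubmonoid) {V : Submodule k (SkewAut k L)}
    (hV : RightFG (fracAlg ((fixedSubalgebra P G).map (skewCoeff k L))) V) :
    RightFG ((fixedSubalgebra P G).map (skewCoeff k L))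
      (V ⊓ Subalgebra.toSubmodule (A ⊓ invSkewMonoidRing M G)) := by
  obtain ⟨T, rfl⟩ := hV
  set Γ := (fixedSubalgebra P G).map (skewCoeff k L)
  have hΓ : Subalgebra.toSubmodule Γ ≤ Subalgebra.toSubmodule (fracAlg Γ) :=
    le_fracAlg (map_skewCoeff_le_range _)
  have hK : Subalgebra.toSubmodule (fracAlg Γ) ≤ Subalgebra.toSubmodule (skewCoeff k L).range :=
    fracAlg_le_range Γ
  have hΓU : Subalgebra.toSubmodule Γ ≤ Subalgebra.toSubmodule (A ⊓ invSkewMonoidRing M G) :=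
    hA.map_fixedSubalgebra_le
  obtain ⟨F, hF⟩ := exists_span_le_supportedOn T
  refine hA.rightFG hG hM (F := F) (inf_le_left.trans ?_) inf_le_right ?_
  · exact (mul_le_mul' hF hK).trans (supportedOn_mul_range_skewCoeff_le F)
  · refine le_inf ((mul_le_mul' inf_le_left hΓ).trans ?_)
      ((mul_le_mul' inf_le_right hΓU).trans ?_)
    · rw [mul_assoc, (fracAlg Γ).isIdempotentElem_toSubmodule.eq]
    · rw [Subalgebra.isIdempotentElem_toSubmodule]

theorem isGaloisOrder [IsFractionRing P L] (hM : M ≤ (autStabilizer P).toSubmonoid)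
    (hconj : ∀ g ∈ G, ∀ m ∈ M, g * m * g⁻¹ ∈ M)
    (hsep : ∀ m ∈ M, ∀ m' ∈ M, m⁻¹ * m' ∈ G → m = m')
    (hfg : (A ⊓ invSkewMonoidRing M G).FG) :
    IsGaloisOrder M G ((fixedSubalgebra P G).map (skewCoeff k L))
      (A ⊓ invSkewMonoidRing M G) where
  __ := hA.isGaloisRing hG hM hconj hsep hfg
  left_order _ _ hV := hA.leftFG_inf hG hV
  right_order _ _ hV := hA.rightFG_inf hG hM hV

end IsSkewOrder

end SkewOrder

/-! ### Symmetric polynomials -/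

section PolynomialDerivatives

open MvPolynomial

variable {k σ : Type*} [Field k]

theorem totalDegree_pderiv_lt {f : MvPolynomial σ k} (hf : f.totalDegree ≠ 0) (i : σ) :
    (pderiv i f).totalDegree < f.totalDegree := by
  rw [totalDegree, Finset.sup_lt_iff (Nat.pos_of_ne_zero hf)]
  intro m hm
  have hm' : m + Finsupp.single i 1 ∈ f.support := by
    rw [mem_support_iff, coeff_pderiv] at hm
    exact mem_support_iff.2 (left_ne_zero_of_mul hm)
  calc m.sum (fun _ e => e) < m.sum (fun _ e => e) + 1 := Nat.lt_succ_self _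
    _ = (m + Finsupp.single i 1).sum fun _ e => e := by
      rw [Finsupp.sum_add_index' (by simp) (by simp), Finsupp.sum_single_index rfl]
    _ ≤ f.totalDegree := le_totalDegree hm'

theorem exists_pderiv_ne_zero [CharZero k] {f : MvPolynomial σ k} (hf : f.totalDegree ≠ 0) :
    ∃ i, pderiv i f ≠ 0 := by
  obtain ⟨s, hs, i, hi⟩ : ∃ s ∈ f.support, ∃ i, s i ≠ 0 := by
    by_contra! h
    exact hf ((totalDegree_eq_zero_iff σ f).2 h)
  refine ⟨i, fun h => ?_⟩
  have hle : Finsupp.single i 1 ≤ s := Finsupp.single_le_iff.2 (Nat.one_le_iff_ne_zero.2 hi)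
  have hcoeff := congrArg (coeff (s - Finsupp.single i 1)) h
  rw [coeff_pderiv, tsub_add_cancel_of_le hle, coeff_zero] at hcoeff
  exact mul_ne_zero (mem_support_iff.1 hs) (Nat.cast_add_one_ne_zero _) hcoeff

theorem one_mem_of_pderiv_mem [CharZero k] {I : Submodule k (MvPolynomial σ k)}
    (hI : ∀ i, ∀ f ∈ I, pderiv i f ∈ I) {f : MvPolynomial σ k} (hf : f ∈ I) (hf0 : f ≠ 0) :
    1 ∈ I := by
  induction h : f.totalDegree using Nat.strong_induction_on generalizing f with
  | _ d ih =>
    subst h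
    by_cases h0 : f.totalDegree = 0
    · rw [totalDegree_eq_zero_iff_eq_C] at h0
      have hc : coeff 0 f ≠ 0 := fun hc => hf0 (by rw [h0, hc, C_0])
      have := I.smul_mem (coeff 0 f)⁻¹ hf
      rwa [h0, coeff_zero_C, smul_eq_C_mul, ← C_mul, inv_mul_cancel₀ hc, C_1] at this
    · obtain ⟨i, hi⟩ := exists_pderiv_ne_zero h0
      exact ih _ (totalDegree_pderiv_lt h0 i) (hI i f hf) hi rfl

end PolynomialDerivatives

section SymmetricPolynomials

open MvPolynomial

variable (k σ : Type*) [Field k] [Finite σ]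

instance finiteType_symmetricSubalgebra : Algebra.FiniteType k (symmetricSubalgebra σ k) := by
  have := Fintype.ofFinite σ
  exact .equiv inferInstance (esymmAlgEquiv σ k rfl)

instance isIntegral_symmetricSubalgebra :
    Algebra.IsIntegral (symmetricSubalgebra σ k) (MvPolynomial σ k) := by
  let _ : MulSemiringAction (Equiv.Perm σ) (MvPolynomial σ k) :=
    { smul := fun π p => rename π p
      one_smul := rename_id_apply
      mul_smul := fun π τ p => (rename_rename τ π p).symm
      smul_zero := fun _ => map_zero _
      smul_add := fun _ => map_add _
      smul_one := fun _ => map_one _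
      smul_mul := fun _ => map_mul _ }
  have : Algebra.IsInvariant (symmetricSubalgebra σ k) (MvPolynomial σ k) (Equiv.Perm σ) :=
    ⟨fun p hp => ⟨⟨p, hp⟩, rfl⟩⟩
  exact Algebra.IsInvariant.isIntegral _ _ (Equiv.Perm σ)

/-- The algebra of symmetric polynomials in the powers `X_i ^ m`. -/
def symmetricPowers (m : ℕ) : Subalgebra k (MvPolynomial σ k) :=
  (symmetricSubalgebra σ k).map (expand m)

instance finiteType_symmetricPowers (m : ℕ) : Algebra.FiniteType k (symmetricPowers k σ m) :=
  (symmetricPowers k σ m).fg_iff_finiteType.1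
    (((symmetricSubalgebra σ k).fg_iff_finiteType.2 inferInstance).map _)

theorem finite_symmetricPowers {m : ℕ} (hm : m ≠ 0) :
    Module.Finite (symmetricPowers k σ m) (MvPolynomial σ k) := by
  have hX (i : σ) : IsIntegral (symmetricPowers k σ m) (X i : MvPolynomial σ k) := by
    have hXm : IsIntegral (symmetricPowers k σ m) (expand m (X i : MvPolynomial σ k)) :=
      (isIntegral_symmetricSubalgebra k σ).isIntegral (X i) |>.map_of_comp_eq
        (((expand m).comp (symmetricSubalgebra σ k).val).codRestrict (symmetricPowers k σ m)
          fun p => ⟨p, p.2, rfl⟩).toRingHom (expand m).toRingHom rfl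
    rw [expand_X] at hXm
    exact hXm.of_pow (Nat.pos_of_ne_zero hm)
  have : Algebra.IsIntegral (symmetricPowers k σ m) (MvPolynomial σ k) := ⟨fun p => by
    induction p using MvPolynomial.induction_on with
    | C c => exact isIntegral_algebraMap (x := algebraMap k (symmetricPowers k σ m) c)
    | add p q hp hq => exact hp.add hq
    | mul_X p i hp => exact hp.mul (hX i)⟩
  have : Algebra.FiniteType (symmetricPowers k σ m) (MvPolynomial σ k) :=
    Algebra.FiniteType.of_restrictScalars_finiteType k _ _
  exact Algebra.IsIntegral.finite

end SymmetricPolynomials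

section Bimodules

open scoped TensorProduct

variable {k S S' A : Type*} [Field k] [CommRing S] [Algebra k S] [CommRing S'] [Algebra k S']
  [Ring A] [Algebra k A]

/-- The action of `S ⊗ S'` on `A` by left multiplications with the image of `S` and right
multiplications with the image of `S'`. -/
def bimoduleAction (f : S →ₐ[k] A) (g : S' →ₐ[k] A) :
    S ⊗[k] S' →ₐ[k] Module.End k A :=
  Algebra.TensorProduct.lift ((Algebra.lmul k A).comp f)
    (AlgHom.ofLinearMap ((LinearMap.mul k A).flip ∘ₗ g.toLinearMap)
      (by ext; simp) fun a b => by
        rw [mul_comm]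
        ext
        simp [mul_assoc])
    fun _ _ => LinearMap.ext fun _ => (mul_assoc _ _ _).symm

theorem bimoduleAction_tmul (f : S →ₐ[k] A) (g : S' →ₐ[k] A) (s : S) (s' : S') (a : A) :
    bimoduleAction f g (s ⊗ₜ s') a = f s * a * g s' :=
  (mul_assoc _ _ _).symm

theorem bimoduleAction_mem {f : S →ₐ[k] A} {g : S' →ₐ[k] A} {U : Subalgebra k A}
    (hf : f.range ≤ U) (hg : g.range ≤ U) (z : S ⊗[k] S') {u : A} (hu : u ∈ U) :
    bimoduleAction f g z u ∈ U := by
  induction z with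
  | zero => simp
  | tmul s s' =>
    rw [bimoduleAction_tmul]
    exact U.mul_mem (U.mul_mem (hf ⟨s, rfl⟩) hu) (hg ⟨s', rfl⟩)
  | add z w hz hw => simpa using U.add_mem hz hw

theorem span_bimoduleAction_eq_top {f : S →ₐ[k] A} {g : S' →ₐ[k] A} {T : Set A}
    (hT : Subalgebra.toSubmodule f.range * Submodule.span k T *
      Subalgebra.toSubmodule g.range = ⊤) :
    Submodule.span k {a | ∃ z, ∃ t ∈ T, bimoduleAction f g z t = a} = ⊤ := by
  rw [eq_top_iff, ← hT, ← Submodule.span_eq (Subalgebra.toSubmodule f.range),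
    ← Submodule.span_eq (Subalgebra.toSubmodule g.range), Submodule.span_mul_span,
    Submodule.span_mul_span]
  refine Submodule.span_mono ?_
  rintro _ ⟨_, ⟨_, ⟨s, rfl⟩, t, ht, rfl⟩, _, ⟨s', rfl⟩, rfl⟩
  exact ⟨s ⊗ₜ s', t, ht, bimoduleAction_tmul f g s s' t⟩

theorem exists_finset_eq_range_sup_range_sup_adjoin [Algebra.FiniteType k S]
    [Algebra.FiniteType k S'] {f : S →ₐ[k] A} {g : S' →ₐ[k] A} {T : Finset A}
    (hT : Subalgebra.toSubmodule f.range * Submodule.span k (T : Set A) *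
      Subalgebra.toSubmodule g.range = ⊤)
    {U : Subalgebra k A} (hf : f.range ≤ U) (hg : g.range ≤ U) :
    ∃ T' : Finset A, U = f.range ⊔ g.range ⊔ Algebra.adjoin k (T' : Set A) := by
  let _ : Module (S ⊗[k] S') A := Module.compHom A (bimoduleAction f g).toRingHom
  have : IsScalarTower k (S ⊗[k] S') A := ⟨fun c z a => by
    change bimoduleAction f g (c • z) a = c • bimoduleAction f g z a
    rw [map_smul, LinearMap.smul_apply]⟩
  have : Algebra.FiniteType k (S ⊗[k] S') := .trans (S := S) inferInstance inferInstance
  have : IsNoetherianRing (S ⊗[k] S') := Algebra.FiniteType.isNoetherianRing k _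
  have : Module.Finite (S ⊗[k] S') A := ⟨T, by
    rw [← Submodule.restrictScalars_eq_top_iff k, eq_top_iff, ← span_bimoduleAction_eq_top hT,
      Submodule.span_le]
    rintro _ ⟨z, t, ht, rfl⟩
    exact Submodule.smul_mem _ z (Submodule.subset_span ht)⟩
  let N (V : Subalgebra k A) (hf : f.range ≤ V) (hg : g.range ≤ V) : Submodule (S ⊗[k] S') A :=
    { V with smul_mem' := fun z _ hv => bimoduleAction_mem hf hg z hv }
  obtain ⟨T', hT'⟩ := IsNoetherian.noetherian (N U hf hg)
  refine ⟨T', le_antisymm (fun u hu => ?_) (sup_le (sup_le hf hg) (Algebra.adjoin_le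
    fun t ht => hT'.le (Submodule.subset_span ht)))⟩
  let V := f.range ⊔ g.range ⊔ Algebra.adjoin k (T' : Set A)
  have hV : (T' : Set A) ⊆ V :=
    Algebra.subset_adjoin.trans (SetLike.coe_subset_coe.2 le_sup_right)
  exact (Submodule.span_le (p := N V (le_sup_left.trans le_sup_left)
    (le_sup_right.trans le_sup_left))).2 hV (hT'.ge hu)

theorem subalgebra_fg_of_bimodule [Algebra.FiniteType k S] [Algebra.FiniteType k S']
    {f : S →ₐ[k] A} {g : S' →ₐ[k] A} {T : Finset A}
    (hT : Subalgebra.toSubmodule f.range * Submodule.span k (T : Set A) *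
      Subalgebra.toSubmodule g.range = ⊤)
    {U : Subalgebra k A} (hf : f.range ≤ U) (hg : g.range ≤ U) : U.FG := by
  obtain ⟨T', rfl⟩ := exists_finset_eq_range_sup_range_sup_adjoin hT hf hg
  rw [← Algebra.map_top f, ← Algebra.map_top g]
  exact ((Algebra.FiniteType.out.map f).sup (Algebra.FiniteType.out.map g)).sup ⟨T', rfl⟩

end Bimodules

/-! ### The Weyl algebra -/

section CommEval

variable {k B σ : Type*} [CommRing k] [Ring B] [Algebra k B]

open scoped IsMulCommutative

/-- Evaluation of polynomials at a commuting family of elements of a noncommutative algebra. -/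
def commEval (f : σ → B) (hf : ∀ i j, f i * f j = f j * f i) : MvPolynomial σ k →ₐ[k] B :=
  haveI : IsMulCommutative (Algebra.adjoin k (Set.range f)) := Algebra.isMulCommutative_adjoin k (by
    rintro _ ⟨i, rfl⟩ _ ⟨j, rfl⟩
    exact hf i j)
  (Algebra.adjoin k (Set.range f)).val.comp
    (MvPolynomial.aeval fun i => ⟨f i, Algebra.subset_adjoin ⟨i, rfl⟩⟩)

theorem commEval_X (f : σ → B) (hf : ∀ i j, f i * f j = f j * f i) (i : σ) :
    commEval (k := k) f hf (MvPolynomial.X i) = f i := by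
  simp [commEval]

end CommEval

namespace WeylAlgebra

open MvPolynomial

variable {k : Type*} [Field k] {n : ℕ}

theorem d_mul_x_eq (i j : Fin n) : d k i * x k j = x k j * d k i + if i = j then 1 else 0 :=
  eq_add_of_sub_eq' (d_mul_x k i j)

theorem eq_top_of_generators_mem {S : Subalgebra k (WeylAlgebra k n)} (hx : ∀ i, x k i ∈ S)
    (hd : ∀ i, d k i ∈ S) : S = ⊤ := by
  let f : WeylAlgebra k n →ₐ[k] S := lift (fun i => ⟨x k i, hx i⟩) (fun i => ⟨d k i, hd i⟩)
    (fun i j => Subtype.ext (x_mul_x k i j)) (fun i j => Subtype.ext (d_mul_d k i j))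
    (fun i j => Subtype.ext (by
      have := d_mul_x k i j
      split_ifs at this ⊢ <;> exact this))
  have hf : S.val.comp f = AlgHom.id k _ :=
    hom_ext (fun i => by simp [f, lift_x]) (fun i => by simp [f, lift_d])
  refine eq_top_iff.2 fun u _ => ?_
  have hu : (f u : WeylAlgebra k n) = u := DFunLike.congr_fun hf u
  exact hu ▸ (f u).2

theorem eq_top_of_generators_mul_mem {V : Submodule k (WeylAlgebra k n)} (h1 : 1 ∈ V)
    (hx : ∀ i, ∀ v ∈ V, x k i * v ∈ V) (hd : ∀ i, ∀ v ∈ V, d k i * v ∈ V) : V = ⊤ := by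
  let S : Subalgebra k (WeylAlgebra k n) :=
    { carrier := {u | ∀ v ∈ V, u * v ∈ V}
      mul_mem' := fun {a b} ha hb v hv => by
        rw [mul_assoc]
        exact ha _ (hb v hv)
      add_mem' := fun {a b} ha hb v hv => by
        rw [add_mul]
        exact V.add_mem (ha v hv) (hb v hv)
      algebraMap_mem' := fun c v hv => by
        rw [← Algebra.smul_def]
        exact V.smul_mem c hv }
  have hS : S = ⊤ := eq_top_of_generators_mem hx hd
  refine eq_top_iff.2 fun u _ => ?_
  have hu : u ∈ S := hS ▸ Algebra.mem_top
  simpa using hu 1 h1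

variable (k n) in
/-- The normally ordered element of the Weyl algebra given by a polynomial in the variables
`x_i` (`Sum.inl i`) and `∂_i` (`Sum.inr i`): each monomial is read with the `x_i` to the left of
the `∂_i`. It is obtained by letting `x_i` and `∂_i` act on `1` by left and by right multiplication,
respectively. -/
def normalOrder : MvPolynomial (Fin n ⊕ Fin n) k →ₗ[k] WeylAlgebra k n :=
  LinearMap.applyₗ (1 : WeylAlgebra k n) ∘ₗ AlgHom.toLinearMap (commEval
    (Sum.elim (fun i => LinearMap.mulLeft k (x k i)) fun i => LinearMap.mulRight k (d k i)) (by
      rintro (i | i) (j | j) <;> ext u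
      · simp [← mul_assoc, x_mul_x k i j]
      · simp [← mul_assoc]
      · simp [← mul_assoc]
      · simp [mul_assoc, d_mul_d k i j]))

theorem normalOrder_C (c : k) : normalOrder k n (C c) = algebraMap k _ c := by
  rw [← algebraMap_eq, normalOrder, LinearMap.comp_apply, AlgHom.toLinearMap_apply,
    AlgHom.commutes, Algebra.algebraMap_eq_smul_one (A := WeylAlgebra k n)]
  rfl

theorem normalOrder_one : normalOrder k n 1 = 1 := by
  rw [← C_1, normalOrder_C, map_one]

theorem normalOrder_mul_X_inl (q : MvPolynomial (Fin n ⊕ Fin n) k) (i : Fin n) :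
    normalOrder k n (q * X (Sum.inl i)) = x k i * normalOrder k n q := by
  rw [mul_comm, normalOrder, LinearMap.comp_apply, AlgHom.toLinearMap_apply, map_mul, commEval_X]
  rfl

theorem normalOrder_mul_X_inr (q : MvPolynomial (Fin n ⊕ Fin n) k) (i : Fin n) :
    normalOrder k n (q * X (Sum.inr i)) = normalOrder k n q * d k i := by
  rw [mul_comm, normalOrder, LinearMap.comp_apply, AlgHom.toLinearMap_apply, map_mul, commEval_X]
  rfl

theorem d_mul_normalOrder (q : MvPolynomial (Fin n ⊕ Fin n) k) (i : Fin n) :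
    d k i * normalOrder k n q =
      normalOrder k n q * d k i + normalOrder k n (pderiv (Sum.inl i) q) := by
  induction q using MvPolynomial.induction_on with
  | C c => simp [normalOrder_C, Algebra.commutes]
  | add p q hp hq => rw [map_add, mul_add, add_mul, hp, hq, map_add, map_add, add_add_add_comm]
  | mul_X p j hp =>
    rw [Derivation.leibniz, smul_eq_mul, smul_eq_mul, map_add, mul_comm (X j)]
    rcases j with j | j
    · rw [normalOrder_mul_X_inl, normalOrder_mul_X_inl, ← mul_assoc, d_mul_x_eq, add_mul,
        mul_assoc, hp, mul_add, mul_assoc]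
      by_cases hij : i = j
      · subst hij
        simp only [↓reduceIte, one_mul, pderiv_X_self, mul_one]
        abel
      · simp [hij, pderiv_X]
    · rw [normalOrder_mul_X_inr, normalOrder_mul_X_inr, ← mul_assoc, hp, add_mul, mul_assoc,
        mul_assoc, d_mul_d k i j]
      simp [pderiv_X]

theorem normalOrder_mul_x (q : MvPolynomial (Fin n ⊕ Fin n) k) (i : Fin n) :
    normalOrder k n q * x k i =
      x k i * normalOrder k n q + normalOrder k n (pderiv (Sum.inr i) q) := by
  induction q using MvPolynomial.induction_on with
  | C c => simp [normalOrder_C, Algebra.commutes]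
  | add p q hp hq => rw [map_add, mul_add, add_mul, hp, hq, map_add, map_add, add_add_add_comm]
  | mul_X p j hp =>
    rw [Derivation.leibniz, smul_eq_mul, smul_eq_mul, map_add, mul_comm (X j)]
    rcases j with j | j
    · rw [normalOrder_mul_X_inl, normalOrder_mul_X_inl, mul_assoc, hp, mul_add, ← mul_assoc,
        ← mul_assoc, x_mul_x k i j]
      simp [pderiv_X]
    · rw [normalOrder_mul_X_inr, normalOrder_mul_X_inr, mul_assoc, d_mul_x_eq, mul_add,
        ← mul_assoc, hp, add_mul, ← mul_assoc]
      by_cases hij : i = j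
      · subst hij
        simp only [↓reduceIte, mul_one, pderiv_X_self]
        abel
      · simp [pderiv_X, Ne.symm hij]

theorem normalOrder_surjective : Function.Surjective (normalOrder k n) := by
  refine LinearMap.range_eq_top.1 (eq_top_of_generators_mul_mem ⟨1, normalOrder_one⟩ ?_ ?_)
  · rintro i _ ⟨q, rfl⟩
    exact ⟨q * X (Sum.inl i), normalOrder_mul_X_inl q i⟩
  · rintro i _ ⟨q, rfl⟩
    exact ⟨q * X (Sum.inr i) + pderiv (Sum.inl i) q, by
      rw [map_add, normalOrder_mul_X_inr, d_mul_normalOrder]⟩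

/-- Commutators with `∂_i` and `x_i` differentiate normally ordered elements, so a nonzero kernel
would contain `1`. -/
theorem injective_of_algHom [CharZero k] {B : Type*} [Ring B] [Algebra k B] [Nontrivial B]
    (f : WeylAlgebra k n →ₐ[k] B) : Function.Injective f := by
  let I := LinearMap.ker (f.toLinearMap ∘ₗ normalOrder k n)
  have hI : ∀ i, ∀ q ∈ I, pderiv i q ∈ I := by
    rintro (i | i) q (hq : f (normalOrder k n q) = 0)
    · simpa [I, hq] using (congrArg f (d_mul_normalOrder q i)).symm
    · simpa [I, hq] using (congrArg f (normalOrder_mul_x q i)).symm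
  have h1 : (1 : MvPolynomial (Fin n ⊕ Fin n) k) ∉ I := by simp [I, normalOrder_one]
  refine (injective_iff_map_eq_zero f).2 fun u hu => ?_
  obtain ⟨q, rfl⟩ := normalOrder_surjective u
  by_contra hne
  exact h1 (one_mem_of_pderiv_mem hI hu (by rintro rfl; simp at hne))

variable (k n) in
/-- The homomorphism `k[X_1, …, X_n] → A_n` with `X_i ↦ x_i`. -/
def xPoly : MvPolynomial (Fin n) k →ₐ[k] WeylAlgebra k n := commEval (x k) (x_mul_x k)

variable (k n) in
/-- The homomorphism `k[X_1, …, X_n] → A_n` with `X_i ↦ ∂_i`. -/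
def dPoly : MvPolynomial (Fin n) k →ₐ[k] WeylAlgebra k n := commEval (d k) (d_mul_d k)

theorem xPoly_X (i : Fin n) : xPoly k n (X i) = x k i := commEval_X _ _ i

theorem dPoly_X (i : Fin n) : dPoly k n (X i) = d k i := commEval_X _ _ i

theorem range_xPoly_mul_range_dPoly :
    Subalgebra.toSubmodule (xPoly k n).range * Subalgebra.toSubmodule (dPoly k n).range = ⊤ := by
  let P := Subalgebra.toSubmodule (xPoly k n).range
  let D := Subalgebra.toSubmodule (dPoly k n).range
  have hPP : P * P = P := Subalgebra.isIdempotentElem_toSubmodule _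
  have hDD : D * D = D := Subalgebra.isIdempotentElem_toSubmodule _
  have hone : 1 ∈ P * D :=
    mul_one (1 : WeylAlgebra k n) ▸ Submodule.mul_mem_mul (one_mem (xPoly k n).range)
      (one_mem (dPoly k n).range)
  change P * D = ⊤
  refine eq_top_iff.2 fun u _ => ?_
  obtain ⟨q, rfl⟩ := normalOrder_surjective u
  induction q using MvPolynomial.induction_on with
  | C c =>
    rw [normalOrder_C, Algebra.algebraMap_eq_smul_one]
    exact Submodule.smul_mem _ c hone
  | add p q hp hq =>
    rw [map_add]
    exact Submodule.add_mem _ (hp trivial) (hq trivial)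
  | mul_X q i hq =>
    rcases i with i | i
    · rw [normalOrder_mul_X_inl, ← hPP, mul_assoc]
      exact Submodule.mul_mem_mul ⟨X i, xPoly_X i⟩ (hq trivial)
    · rw [normalOrder_mul_X_inr, ← hDD, ← mul_assoc]
      exact Submodule.mul_mem_mul (hq trivial) ⟨X i, dPoly_X i⟩

theorem permHom_comp_xPoly (π : Equiv.Perm (Fin n)) :
    (permHom π).comp (xPoly k n) = (xPoly k n).comp (rename π) :=
  algHom_ext fun i => by simp [xPoly_X, permHom_x]

theorem permHom_comp_dPoly (π : Equiv.Perm (Fin n)) :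
    (permHom π).comp (dPoly k n) = (dPoly k n).comp (rename π) :=
  algHom_ext fun i => by simp [dPoly_X, permHom_d]

theorem torusHom_comp_xPoly_comp_expand {m : ℕ} {a : Fin n → kˣ} (ha : a ^ m = 1) :
    (torusHom a).comp ((xPoly k n).comp (expand m)) = (xPoly k n).comp (expand m) :=
  algHom_ext fun i => by
    have hi : (((a i)⁻¹ : kˣ) : k) ^ m = 1 := by
      rw [← Units.val_pow_eq_pow_val, inv_pow, ← Pi.pow_apply, ha]
      simp
    simp only [AlgHom.comp_apply, expand_X, map_pow, xPoly_X, torusHom_x, smul_pow, hi, one_smul]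

theorem torusHom_comp_dPoly_comp_expand {m : ℕ} {a : Fin n → kˣ} (ha : a ^ m = 1) :
    (torusHom a).comp ((dPoly k n).comp (expand m)) = (dPoly k n).comp (expand m) :=
  algHom_ext fun i => by
    have hi : ((a i : kˣ) : k) ^ m = 1 := by
      rw [← Units.val_pow_eq_pow_val, ← Pi.pow_apply, ha]
      simp
    simp only [AlgHom.comp_apply, expand_X, map_pow, dPoly_X, torusHom_d, smul_pow, hi, one_smul]

open scoped Pointwise in
theorem subalgebra_fg {U : Subalgebra k (WeylAlgebra k n)} {m : ℕ} (hm : m ≠ 0)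
    (hx : (symmetricPowers k (Fin n) m).map (xPoly k n) ≤ U)
    (hd : (symmetricPowers k (Fin n) m).map (dPoly k n) ≤ U) : U.FG := by
  have := finite_symmetricPowers k (Fin n) hm
  obtain ⟨T₁, hT₁⟩ := (leftFG_top (symmetricPowers k (Fin n) m)).map
    (xPoly k n)
  obtain ⟨T₂, hT₂⟩ := (rightFG_top (symmetricPowers k (Fin n) m)).map
    (dPoly k n)
  classical
  refine subalgebra_fg_of_bimodule (f := (xPoly k n).comp (symmetricPowers k (Fin n) m).val)
    (g := (dPoly k n).comp (symmetricPowers k (Fin n) m).val) (T := T₁ * T₂) ?_ ?_ ?_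
  · rw [AlgHom.range_comp, Subalgebra.range_val, AlgHom.range_comp, Subalgebra.range_val,
      Finset.coe_mul, ← Submodule.span_mul_span, ← mul_assoc, ← hT₁, mul_assoc, ← hT₂,
      ← range_xPoly_mul_range_dPoly, Submodule.map_top, Submodule.map_top]
    rfl
  · rwa [AlgHom.range_comp, Subalgebra.range_val]
  · rwa [AlgHom.range_comp, Subalgebra.range_val]

end WeylAlgebra

/-! ### The field `k(t_1, …, t_n)` -/

section RatField

variable (k : Type*) [Field k] (n : ℕ)

/-- The subalgebra `k[t_1, …, t_n]` of `k(t_1, …, t_n)`. -/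
def polyRange : Subalgebra k (RatField k n) :=
  (IsScalarTower.toAlgHom k (MvPolynomial (Fin n) k) (RatField k n)).range

theorem polyRange_eq_adjoin : polyRange k n = Algebra.adjoin k (Set.range (ratVar k n)) := by
  rw [polyRange, ← Algebra.map_top, ← MvPolynomial.adjoin_range_X, AlgHom.map_adjoin,
    ← Set.range_comp]
  rfl

instance finiteType_polyRange : Algebra.FiniteType k (polyRange k n) :=
  .of_surjective (AlgHom.rangeRestrict _) (AlgHom.rangeRestrict_surjective _)

instance isFractionRing_polyRange : IsFractionRing (polyRange k n) (RatField k n) :=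
  .of_field _ _ fun l => by
    obtain ⟨p, q, -, rfl⟩ := IsFractionRing.div_surjective (A := MvPolynomial (Fin n) k) l
    exact ⟨⟨_, p, rfl⟩, ⟨_, q, rfl⟩, rfl⟩

variable {k n}

theorem ratVar_mem_polyRange (i : Fin n) : ratVar k n i ∈ polyRange k n := ⟨MvPolynomial.X i, rfl⟩

theorem ratVar_ne_zero (i : Fin n) : ratVar k n i ≠ 0 := by
  rw [ratVar, Ne, map_eq_zero_iff _ (IsFractionRing.injective _ _)]
  exact MvPolynomial.X_ne_zero i

open scoped Pointwise in
theorem range_ratExtend_le : (ratExtend k n).range ≤ autStabilizer (polyRange k n) := by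
  rintro _ ⟨f, rfl⟩
  refine MulAction.mem_stabilizer_iff.2 (Subring.ext fun l => ?_)
  have ratExtend_algebraMap (p : MvPolynomial (Fin n) k) :
      ratExtend k n f (algebraMap _ _ p) = algebraMap _ _ (f p) := by
    simp [ratExtend]
  constructor
  · rintro ⟨_, ⟨p, rfl⟩, rfl⟩
    exact ⟨f p, (ratExtend_algebraMap p).symm⟩
  · rintro ⟨p, rfl⟩
    exact ⟨_, ⟨f.symm p, rfl⟩, (ratExtend_algebraMap _).trans (by simp)⟩

theorem shift_mem_autStabilizer (a : Multiplicative (Fin n → ℤ)) :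
    shift k n a ∈ autStabilizer (polyRange k n) := range_ratExtend_le ⟨_, rfl⟩

theorem permRat_mem_autStabilizer (π : Equiv.Perm (Fin n)) :
    permRat k n π ∈ autStabilizer (polyRange k n) := range_ratExtend_le ⟨_, rfl⟩

theorem ratAut_ext {f g : RatField k n ≃ₐ[k] RatField k n}
    (h : ∀ i, f (ratVar k n i) = g (ratVar k n i)) : f = g := by
  have h_poly := MvPolynomial.algHom_ext
    (f := (f : RatField k n →ₐ[k] RatField k n).comp
      (IsScalarTower.toAlgHom k (MvPolynomial (Fin n) k) (RatField k n)))
    (g := (g : RatField k n →ₐ[k] RatField k n).comp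
      (IsScalarTower.toAlgHom k (MvPolynomial (Fin n) k) (RatField k n))) h
  exact AlgEquiv.coe_toAlgHom_injective
    (IsLocalization.algHom_ext (nonZeroDivisors (MvPolynomial (Fin n) k)) h_poly)

theorem permRat_conj_sigma (π : Equiv.Perm (Fin n)) (i : Fin n) :
    permRat k n π * sigma k n i * (permRat k n π)⁻¹ = sigma k n (π i) := by
  rw [mul_inv_eq_iff_eq_mul]
  refine ratAut_ext fun j => ?_
  simp only [AlgEquiv.mul_apply, permRat_ratVar, sigma_ratVar, map_sub, π.injective.eq_iff]
  split_ifs <;> simp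

theorem shiftMonoid_le_iff {m : ℕ} {S : Subgroup (RatField k n ≃ₐ[k] RatField k n)} :
    shiftMonoid k n m ≤ S.toSubmonoid ↔ ∀ i, sigma k n i ^ m ∈ S :=
  (Subgroup.closure_le S).trans Set.range_subset_iff

theorem shiftMonoid_le_autStabilizer (m : ℕ) :
    shiftMonoid k n m ≤ (autStabilizer (polyRange k n)).toSubmonoid :=
  shiftMonoid_le_iff.2 fun _ => pow_mem (shift_mem_autStabilizer _) m

theorem sigma_pow_mem_shiftMonoid (m : ℕ) (i : Fin n) : sigma k n i ^ m ∈ shiftMonoid k n m :=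
  Subgroup.subset_closure ⟨i, rfl⟩

theorem sigma_pow (i : Fin n) (m : ℕ) :
    sigma k n i ^ m = shift k n (Multiplicative.ofAdd (Pi.single i 1) ^ m) :=
  (map_pow (shift k n) _ m).symm

theorem permRat_conj_mem_shiftMonoid {m : ℕ} (π : Equiv.Perm (Fin n))
    {g : RatField k n ≃ₐ[k] RatField k n} (hg : g ∈ shiftMonoid k n m) :
    permRat k n π * g * (permRat k n π)⁻¹ ∈ shiftMonoid k n m := by
  let S := (Subgroup.closure (Set.range fun i => sigma k n i ^ m)).comap
    (MulAut.conj (permRat k n π)).toMonoidHom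
  refine (shiftMonoid_le_iff (S := S)).2 (fun i => ?_) hg
  change permRat k n π * sigma k n i ^ m * (permRat k n π)⁻¹ ∈ shiftMonoid k n m
  rw [← conj_pow, permRat_conj_sigma]
  exact sigma_pow_mem_shiftMonoid m (π i)

theorem mem_shiftMonoid {m : ℕ} {g : RatField k n ≃ₐ[k] RatField k n} :
    g ∈ shiftMonoid k n m ↔ ∃ a, shift k n (a ^ m) = g := by
  constructor
  · have h_le : shiftMonoid k n m ≤ ((shift k n).comp (powMonoidHom m)).range.toSubmonoid :=
      shiftMonoid_le_iff.2 fun i => by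
        rw [sigma_pow]
        exact ⟨Multiplicative.ofAdd (Pi.single i 1), rfl⟩
    exact fun hg => h_le hg
  · rintro ⟨a, rfl⟩
    change a ∈ (Subgroup.closure (Set.range fun i => sigma k n i ^ m)).comap
      ((shift k n).comp (powMonoidHom m))
    have ha : a = ∏ i, Multiplicative.ofAdd (Pi.single i 1) ^ a.toAdd i := by
      refine Multiplicative.toAdd.injective (funext fun j => ?_)
      simp [toAdd_prod, Finset.sum_apply, Pi.single_apply]
    rw [ha]
    refine prod_mem fun i _ => zpow_mem ?_ _
    rw [Subgroup.mem_comap, MonoidHom.comp_apply, powMonoidHom_apply, ← sigma_pow]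
    exact sigma_pow_mem_shiftMonoid m i

theorem disjoint_range_shift_range_permRat [CharZero k] :
    Disjoint (shift k n).range (permRat k n).range := by
  refine Subgroup.disjoint_def.2 ?_
  rintro _ ⟨a, rfl⟩ ⟨π, hπ⟩
  suffices ha : a = 1 by rw [ha, map_one]
  refine Multiplicative.toAdd.injective (funext fun i => ?_)
  have h_poly : MvPolynomial.X (π i) =
      MvPolynomial.X i - MvPolynomial.C (a.toAdd i : k) := by
    apply IsFractionRing.injective (MvPolynomial (Fin n) k) (RatField k n)
    have h := DFunLike.congr_fun hπ (ratVar k n i)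
    rw [shift_ratVar, permRat_ratVar,
      IsScalarTower.algebraMap_apply k (MvPolynomial (Fin n) k) (RatField k n)] at h
    exact h.trans (map_sub _ _ _).symm
  simpa using congrArg (MvPolynomial.eval 0) h_poly

theorem eq_of_inv_mul_mem_map_permRat [CharZero k] {m : ℕ} {H : Subgroup (Equiv.Perm (Fin n))}
    {g h : RatField k n ≃ₐ[k] RatField k n} (hg : g ∈ shiftMonoid k n m)
    (hh : h ∈ shiftMonoid k n m) (hgh : g⁻¹ * h ∈ H.map (permRat k n)) : g = h := by
  obtain ⟨a, rfl⟩ := mem_shiftMonoid.1 hg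
  obtain ⟨b, rfl⟩ := mem_shiftMonoid.1 hh
  exact inv_mul_eq_one.1 (Subgroup.disjoint_def.1 disjoint_range_shift_range_permRat
    (mul_mem (inv_mem ⟨_, rfl⟩) ⟨_, rfl⟩) (Subgroup.map_le_range _ _ hgh))

end RatField

/-! ### The embedding of the Weyl algebra -/

section Embedding

open WeylAlgebra SkewMonoidAlgebra

variable {k : Type*} [Field k] {n : ℕ}

theorem weylEmbedding_x (i : Fin n) :
    weylEmbedding k n (x k i) = single (sigma k n i) 1 := lift_x _ _ _ _ _ i

theorem weylEmbedding_d (i : Fin n) :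
    weylEmbedding k n (d k i) = single (sigma k n i)⁻¹ (ratVar k n i) := lift_d _ _ _ _ _ i

theorem weylEmbedding_injective [CharZero k] : Function.Injective (weylEmbedding k n) :=
  injective_of_algHom _

theorem map_adjoin_t : (Algebra.adjoin k (Set.range (t k))).map (weylEmbedding k n) =
    (polyRange k n).map (skewCoeff k (RatField k n)) := by
  have weylEmbedding_t (i : Fin n) :
      weylEmbedding k n (t k i) = skewCoeff k _ (ratVar k n i) := by
    rw [t, map_mul, weylEmbedding_x, weylEmbedding_d, single_mul_single, skewCoeff_apply]
    simp
  rw [polyRange_eq_adjoin, AlgHom.map_adjoin, AlgHom.map_adjoin, ← Set.range_comp, ← Set.range_comp]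
  exact congrArg (fun f => Algebra.adjoin k (Set.range f)) (funext weylEmbedding_t)

theorem range_weylEmbedding_le :
    (weylEmbedding k n).range ≤ skewMonoidRing (shiftMonoid k n 1) := by
  have sigma_mem (i : Fin n) :
      sigma k n i ∈ Subgroup.closure (Set.range fun i => sigma k n i ^ 1) :=
    Subgroup.subset_closure ⟨i, pow_one _⟩
  have h_top : (skewMonoidRing (shiftMonoid k n 1)).comap (weylEmbedding k n) = ⊤ := by
    refine eq_top_of_generators_mem (fun i => ?_) (fun i => ?_)
    · rw [Subalgebra.mem_comap, weylEmbedding_x]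
      exact single_mem_skewMonoidRing (sigma_mem i) _
    · rw [Subalgebra.mem_comap, weylEmbedding_d]
      exact single_mem_skewMonoidRing (Subgroup.inv_mem _ (sigma_mem i)) _
  rintro _ ⟨u, rfl⟩
  exact h_top.ge (Algebra.mem_top (x := u))

theorem exists_shift_eq_of_mem_support {u : WeylAlgebra k n} {g : RatField k n ≃ₐ[k] RatField k n}
    (hg : g ∈ (weylEmbedding k n u).support) : ∃ a, shift k n a = g := by
  obtain ⟨a, rfl⟩ := mem_shiftMonoid.1 (range_weylEmbedding_le ⟨u, rfl⟩ g hg)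
  exact ⟨a ^ 1, rfl⟩

theorem coeff_weylEmbedding_x_mul (i : Fin n) (u : WeylAlgebra k n)
    (g : RatField k n ≃ₐ[k] RatField k n) :
    (weylEmbedding k n (x k i * u)).coeff g =
      sigma k n i ((weylEmbedding k n u).coeff ((sigma k n i)⁻¹ * g)) := by
  rw [map_mul, weylEmbedding_x, coeff_single_mul, one_mul, AlgEquiv.smul_def]

theorem coeff_weylEmbedding_d_mul (i : Fin n) (u : WeylAlgebra k n)
    (g : RatField k n ≃ₐ[k] RatField k n) :
    (weylEmbedding k n (d k i * u)).coeff g =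
      ratVar k n i * (sigma k n i)⁻¹ ((weylEmbedding k n u).coeff (sigma k n i * g)) := by
  rw [map_mul, weylEmbedding_d, coeff_single_mul, inv_inv, AlgEquiv.smul_def]

theorem coeff_weylEmbedding_mem_polyRange (u : WeylAlgebra k n)
    (g : RatField k n ≃ₐ[k] RatField k n) : (weylEmbedding k n u).coeff g ∈ polyRange k n := by
  let V : Submodule k (WeylAlgebra k n) :=
    { carrier := {u | ∀ g, (weylEmbedding k n u).coeff g ∈ polyRange k n}
      zero_mem' := fun g => by simp
      add_mem' := fun hu hv g => by
        rw [map_add, coeff_add]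
        exact add_mem (hu g) (hv g)
      smul_mem' := fun c u hu g => by
        rw [map_smul, coeff_smul]
        exact Subalgebra.smul_mem _ (hu g) c }
  have sigma_mem (i : Fin n) : sigma k n i ∈ autStabilizer (polyRange k n) :=
    shift_mem_autStabilizer _
  have hV : V = ⊤ := by
    refine eq_top_of_generators_mul_mem (fun g => ?_) (fun i u hu g => ?_) (fun i u hu g => ?_)
    · classical
      rw [map_one, one_def, coeff_single_apply]
      split_ifs
      exacts [one_mem _, zero_mem _]
    · rw [coeff_weylEmbedding_x_mul]
      exact apply_mem_of_mem_autStabilizer (sigma_mem i) (hu _)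
    · rw [coeff_weylEmbedding_d_mul]
      exact mul_mem (ratVar_mem_polyRange i)
        (apply_mem_of_mem_autStabilizer (inv_mem (sigma_mem i)) (hu _))
  exact hV.ge (Submodule.mem_top (x := u)) g

/-- The monoid of the automorphisms `g` of `L` such that the subalgebra `A` of the skew group ring
contains a nonzero multiple `c g` of `g`. -/
def monomialSupport {L : Type*} [Field L] [Algebra k L] (A : Subalgebra k (SkewAut k L)) :
    Submonoid (L ≃ₐ[k] L) where
  carrier := {g | ∃ c ≠ 0, single g c ∈ A}
  one_mem' := ⟨1, one_ne_zero, one_mem A⟩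
  mul_mem' := by
    rintro g h ⟨c, hc0, hc⟩ ⟨e, he0, he⟩
    refine ⟨c * g e, mul_ne_zero hc0 (by simpa using he0), ?_⟩
    simpa only [single_mul_single, AlgEquiv.smul_def] using mul_mem hc he

theorem shiftMonoid_le_monomialSupport (m : ℕ) :
    shiftMonoid k n m ≤ monomialSupport (weylEmbedding k n).range := by
  rw [shiftMonoid, Subgroup.closure_toSubmonoid, Submonoid.closure_le, Set.union_subset_iff]
  have sigma_mem (i : Fin n) : sigma k n i ∈ monomialSupport (weylEmbedding k n).range :=
    ⟨1, one_ne_zero, x k i, weylEmbedding_x i⟩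
  have sigma_inv_mem (i : Fin n) : (sigma k n i)⁻¹ ∈ monomialSupport (weylEmbedding k n).range :=
    ⟨_, ratVar_ne_zero i, d k i, weylEmbedding_d i⟩
  constructor
  · rintro _ ⟨i, rfl⟩
    exact pow_mem (sigma_mem i) m
  · rintro g ⟨i, hi⟩
    rw [← inv_inv g, ← hi, ← inv_pow]
    exact pow_mem (sigma_inv_mem i) m

theorem isSkewOrder_range_weylEmbedding (m : ℕ) :
    IsSkewOrder (polyRange k n) (shiftMonoid k n m) (weylEmbedding k n).range where
  coeff_mem := by
    rintro _ ⟨u, rfl⟩ g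
    exact coeff_weylEmbedding_mem_polyRange u g
  map_le := by
    rw [← map_adjoin_t, ← Algebra.map_top]
    exact Subalgebra.map_mono le_top
  exists_single_mem _ hg := shiftMonoid_le_monomialSupport m hg

/-- The character `a ↦ ∏ ζ_i ^ (-a_i)` by which `ζ` acts on the component of degree `a` of the
Weyl algebra, for the grading with `x_i` of degree `e_i` and `∂_i` of degree `-e_i`. -/
def torusWeight (ζ : Fin n → kˣ) : Multiplicative (Fin n → ℤ) →* kˣ where
  toFun a := ∏ i, ζ i ^ (-a.toAdd i)
  map_one' := by simp
  map_mul' a b := by simp [zpow_add, Finset.prod_mul_distrib, mul_comm]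

theorem torusWeight_single (ζ : Fin n → kˣ) (i : Fin n) (z : ℤ) :
    torusWeight ζ (Multiplicative.ofAdd (Pi.single i z)) = ζ i ^ (-z) := by
  change ∏ j, ζ j ^ (-Pi.single (M := fun _ => ℤ) i z j) = _
  rw [Finset.prod_eq_single i (fun j _ hj => by rw [Pi.single_eq_of_ne hj, neg_zero, zpow_zero])
    (by simp), Pi.single_eq_same]

theorem coeff_weylEmbedding_torusHom [CharZero k] (ζ : Fin n → kˣ) (u : WeylAlgebra k n)
    (a : Multiplicative (Fin n → ℤ)) :
    (weylEmbedding k n (torusHom ζ u)).coeff (shift k n a) =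
      (torusWeight ζ a : k) • (weylEmbedding k n u).coeff (shift k n a) := by
  let V : Submodule k (WeylAlgebra k n) :=
    { carrier := {u | ∀ a, (weylEmbedding k n (torusHom ζ u)).coeff (shift k n a) =
        (torusWeight ζ a : k) • (weylEmbedding k n u).coeff (shift k n a)}
      zero_mem' := fun a => by simp
      add_mem' := fun hu hv a => by
        simp only [map_add, coeff_add, Finsupp.add_apply, hu a, hv a, smul_add]
      smul_mem' := fun c u hu a => by
        simp only [map_smul, coeff_smul, Finsupp.smul_apply, hu a, smul_comm c] }
  have apply_smul (g : RatField k n ≃ₐ[k] RatField k n) (c : k) (l : RatField k n) :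
      g (c • l) = c • g l := by
    rw [Algebra.smul_def, map_mul, AlgEquiv.commutes, Algebra.smul_def]
  have hV : V = ⊤ := by
    refine eq_top_of_generators_mul_mem (fun a => ?_) (fun i u hu a => ?_) (fun i u hu a => ?_)
    · classical
      rw [map_one, map_one, one_def, coeff_single_apply]
      split_ifs with h
      · rw [shift_injective k n (h.symm.trans (map_one _).symm), map_one, Units.val_one, one_smul]
      · rw [smul_zero]
    · rw [map_mul, torusHom_x, smul_mul_assoc, map_smul, coeff_smul, Finsupp.smul_apply,
        coeff_weylEmbedding_x_mul, coeff_weylEmbedding_x_mul, sigma, ← map_inv, ← map_mul, hu,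
        apply_smul, smul_smul, ← Units.val_mul, map_mul, map_inv, torusWeight_single]
      simp
    · rw [map_mul, torusHom_d, smul_mul_assoc, map_smul, coeff_smul, Finsupp.smul_apply,
        coeff_weylEmbedding_d_mul, coeff_weylEmbedding_d_mul, sigma, ← map_mul, hu,
        apply_smul, mul_smul_comm, smul_smul, ← Units.val_mul, map_mul, torusWeight_single]
      simp
  exact hV.ge (Submodule.mem_top (x := u)) a

theorem torusHom_eq_self_iff [CharZero k] {ζ : Fin n → kˣ} {u : WeylAlgebra k n} :
    torusHom ζ u = u ↔
      ∀ a, shift k n a ∈ (weylEmbedding k n u).support → torusWeight ζ a = 1 := by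
  rw [← weylEmbedding_injective.eq_iff]
  constructor
  · intro h a ha
    have h_coeff := coeff_weylEmbedding_torusHom ζ u a
    rw [h] at h_coeff
    exact Units.ext (smul_left_injective k (mem_support_iff.1 ha)
      (h_coeff.symm.trans (one_smul k _).symm))
  · intro h
    ext g
    by_cases hg : g ∈ (shift k n).range
    · obtain ⟨a, rfl⟩ := hg
      rw [coeff_weylEmbedding_torusHom]
      by_cases ha : shift k n a ∈ (weylEmbedding k n u).support
      · rw [h a ha, Units.val_one, one_smul]
      · rw [notMem_support_iff.1 ha, smul_zero]
    · have coeff_eq_zero (v : WeylAlgebra k n) : (weylEmbedding k n v).coeff g = 0 := by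
        by_contra hv
        exact hg (exists_shift_eq_of_mem_support (mem_support_iff.2 hv))
      rw [coeff_eq_zero, coeff_eq_zero]

theorem forall_torusWeight_eq_one_iff {m : ℕ} (hm : m ≠ 0) {z : k} (hz : IsPrimitiveRoot z m)
    {a : Multiplicative (Fin n → ℤ)} :
    (∀ ζ : Fin n → kˣ, ζ ^ m = 1 → torusWeight ζ a = 1) ↔ ∃ b, b ^ m = a := by
  constructor
  · intro h
    obtain ⟨z, rfl⟩ := hz.isUnit hm
    have hz' : IsPrimitiveRoot z m := IsPrimitiveRoot.coe_units_iff.1 hz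
    have h_dvd (i : Fin n) : (m : ℤ) ∣ a.toAdd i := by
      have h_weight := h (Pi.mulSingle i z) (by
        rw [← Pi.mulSingle_pow, hz'.pow_eq_one, Pi.mulSingle_one])
      rw [← dvd_neg, ← hz'.zpow_eq_one_iff_dvd, ← h_weight]
      change _ = ∏ j, Pi.mulSingle (M := fun _ => kˣ) i z j ^ (-a.toAdd j)
      rw [Finset.prod_eq_single i (fun j _ hj => by rw [Pi.mulSingle_eq_of_ne hj, one_zpow])
        (by simp), Pi.mulSingle_eq_same]
    choose b hb using h_dvd
    exact ⟨Multiplicative.ofAdd b, Multiplicative.toAdd.injective (funext fun i => by simp [hb])⟩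
  · rintro ⟨b, rfl⟩ ζ hζ
    rw [map_pow]
    change (∏ i, ζ i ^ (-b.toAdd i)) ^ m = 1
    rw [← Finset.prod_pow]
    refine Finset.prod_eq_one fun i _ => ?_
    have hζi : ζ i ^ m = 1 := congrFun hζ i
    rw [← zpow_natCast, zpow_comm, zpow_natCast, hζi, one_zpow]

theorem cyclicAct_eq_self_iff [CharZero k] {m : ℕ} (hm : m ≠ 0) {z : k}
    (hz : IsPrimitiveRoot z m) {u : WeylAlgebra k n} :
    (∀ ζ, cyclicAct k n m ζ u = u) ↔
      weylEmbedding k n u ∈ skewMonoidRing (shiftMonoid k n m) := by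
  have h_torus : (∀ ζ, cyclicAct k n m ζ u = u) ↔
      ∀ ζ : Fin n → kˣ, ζ ^ m = 1 → torusHom ζ u = u :=
    ⟨fun h ζ hζ => h fun i => ⟨ζ i, congrFun hζ i⟩, fun h ζ => h _ (funext fun i => (ζ i).2)⟩
  rw [h_torus]
  calc _ ↔ ∀ a, shift k n a ∈ (weylEmbedding k n u).support → ∃ b, b ^ m = a := by
        simp only [torusHom_eq_self_iff, ← forall_torusWeight_eq_one_iff hm hz]
        exact ⟨fun h a ha ζ hζ => h ζ hζ a ha, fun h ζ hζ a ha => h a ha ζ hζ⟩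
    _ ↔ _ := by
        refine ⟨fun h g hg => ?_, fun h a ha => ?_⟩
        · obtain ⟨a, rfl⟩ := exists_shift_eq_of_mem_support hg
          obtain ⟨b, rfl⟩ := h a hg
          exact mem_shiftMonoid.2 ⟨b, rfl⟩
        · obtain ⟨b, hb⟩ := mem_shiftMonoid.1 (h _ ha)
          exact ⟨b, shift_injective k n hb⟩

theorem weylEmbedding_permHom (π : Equiv.Perm (Fin n)) (u : WeylAlgebra k n) :
    weylEmbedding k n (permHom π u) = skewConj (permRat k n π) (weylEmbedding k n u) := by
  have h_comp : (weylEmbedding k n).comp (permHom π) =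
      (skewConj (permRat k n π)).comp (weylEmbedding k n) := by
    refine hom_ext (fun i => ?_) (fun i => ?_) <;> simp only [AlgHom.comp_apply]
    · rw [permHom_x, weylEmbedding_x, weylEmbedding_x, skewConj_single, permRat_conj_sigma, map_one]
    · rw [permHom_d, weylEmbedding_d, weylEmbedding_d, skewConj_single, ← conj_inv,
        permRat_conj_sigma, permRat_ratVar]
  exact DFunLike.congr_fun h_comp u

theorem invariant_iff_weylEmbedding_mem [CharZero k] {m : ℕ} (hm : m ≠ 0) {z : k}
    (hz : IsPrimitiveRoot z m) {H : Subgroup (Equiv.Perm (Fin n))} {u : WeylAlgebra k n} :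
    ((∀ ζ, cyclicAct k n m ζ u = u) ∧ ∀ π ∈ H, permHom π u = u) ↔
      weylEmbedding k n u ∈ invSkewMonoidRing (shiftMonoid k n m) (H.map (permRat k n)) := by
  rw [mem_invSkewMonoidRing, cyclicAct_eq_self_iff hm hz]
  simp only [Subgroup.mem_map, forall_exists_index, and_imp, forall_apply_eq_imp_iff₂,
    ← weylEmbedding_permHom, weylEmbedding_injective.eq_iff]

end Embedding

section Invariants

open WeylAlgebra MvPolynomial

variable {k : Type*} [Field k] {n : ℕ}

theorem mem_weylInvariants {W : Type*} [Group W]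
    {ρ : W →* (WeylAlgebra k n ≃ₐ[k] WeylAlgebra k n)} {u : WeylAlgebra k n} :
    u ∈ weylInvariants ρ ↔ ∀ w, ρ w u = u := by
  simp [weylInvariants, Algebra.mem_iInf, AlgHom.mem_equalizer]

variable (k n) in
/-- The invariants in the Weyl algebra of the group `G_m ^ n ⋊ H` of monomial matrices, for a group
`H` of permutations. The three groups of the theorem are the cases `H = S_n`, `H = 1`, and
`H = 𝒜_n` with `m = 1`. -/
def monomialInvariants (m : ℕ) (H : Subgroup (Equiv.Perm (Fin n))) :
    Subalgebra k (WeylAlgebra k n) :=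
  weylInvariants (cyclicAct k n m) ⊓ weylInvariants (permAct.comp H.subtype)

theorem mem_monomialInvariants {m : ℕ} {H : Subgroup (Equiv.Perm (Fin n))} {u : WeylAlgebra k n} :
    u ∈ monomialInvariants k n m H ↔
      (∀ ζ, cyclicAct k n m ζ u = u) ∧ ∀ π ∈ H, permHom π u = u := by
  rw [monomialInvariants, Algebra.mem_inf, mem_weylInvariants, mem_weylInvariants, Subtype.forall]
  rfl

theorem weylInvariants_shephardToddAct (m : ℕ) :
    weylInvariants (shephardToddAct k n m) = monomialInvariants k n m ⊤ := by
  ext u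
  rw [mem_weylInvariants, mem_monomialInvariants]
  constructor
  · refine fun h => ⟨fun ζ => ?_, fun π _ => ?_⟩
    · simpa only [shephardToddAct, SemidirectProduct.lift_inl] using h (SemidirectProduct.inl ζ)
    · have h_inr := h (SemidirectProduct.inr π)
      rwa [shephardToddAct, SemidirectProduct.lift_inr] at h_inr
  · rintro ⟨h_cyclic, h_perm⟩ w
    have h_right : permAct w.right u = u := h_perm w.right trivial
    rw [← SemidirectProduct.inl_left_mul_inr_right w, map_mul, AlgEquiv.mul_apply, shephardToddAct,
      SemidirectProduct.lift_inl, SemidirectProduct.lift_inr, h_right, h_cyclic]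

theorem weylInvariants_alternatingAct :
    weylInvariants (alternatingAct k n) = monomialInvariants k n 1 (alternatingGroup (Fin n)) := by
  have : Subsingleton (rootsOfUnity 1 k) := by
    rw [rootsOfUnity_one]
    infer_instance
  refine (inf_eq_right.2 fun u _ => mem_weylInvariants.2 fun ζ => ?_).symm
  rw [Subsingleton.elim ζ 1, map_one, AlgEquiv.one_apply]

theorem weylInvariants_cyclicAct (m : ℕ) :
    weylInvariants (cyclicAct k n m) = monomialInvariants k n m ⊥ := by
  refine (inf_eq_left.2 fun u _ => mem_weylInvariants.2 fun π => ?_).symm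
  rw [Subsingleton.elim π 1, map_one, AlgEquiv.one_apply]

theorem map_symmetricPowers_le_monomialInvariants {m : ℕ} (H : Subgroup (Equiv.Perm (Fin n)))
    {f : MvPolynomial (Fin n) k →ₐ[k] WeylAlgebra k n}
    (h_perm : ∀ π, (permHom π).comp f = f.comp (rename π))
    (h_torus : ∀ a : Fin n → kˣ, a ^ m = 1 →
      (torusHom a).comp (f.comp (expand m)) = f.comp (expand m)) :
    (symmetricPowers k (Fin n) m).map f ≤ monomialInvariants k n m H := by
  rintro _ ⟨_, ⟨p, hp, rfl⟩, rfl⟩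
  refine mem_monomialInvariants.2 ⟨fun ζ => ?_, fun π _ => ?_⟩
  · exact DFunLike.congr_fun (h_torus (fun i => ζ i) (funext fun i => (ζ i).2)) p
  · calc permHom π (f (expand m p)) = f (rename π (expand m p)) :=
          DFunLike.congr_fun (h_perm π) (expand m p)
      _ = f (expand m p) := by rw [rename_expand, (mem_symmetricSubalgebra p).1 hp π]

theorem monomialInvariants_fg {m : ℕ} (hm : m ≠ 0) (H : Subgroup (Equiv.Perm (Fin n))) :
    (monomialInvariants k n m H).FG :=
  subalgebra_fg hm
    (map_symmetricPowers_le_monomialInvariants H permHom_comp_xPoly fun _ =>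
      torusHom_comp_xPoly_comp_expand)
    (map_symmetricPowers_le_monomialInvariants H permHom_comp_dPoly fun _ =>
      torusHom_comp_dPoly_comp_expand)

theorem map_permRat_le_autStabilizer (H : Subgroup (Equiv.Perm (Fin n))) :
    H.map (permRat k n) ≤ autStabilizer (polyRange k n) := by
  rintro _ ⟨π, -, rfl⟩
  exact permRat_mem_autStabilizer π

instance finite_map_permRat (H : Subgroup (Equiv.Perm (Fin n))) : Finite (H.map (permRat k n)) :=
  (H : Set (Equiv.Perm (Fin n))).toFinite.image _

variable [CharZero k] {m : ℕ} {z : k} (H : Subgroup (Equiv.Perm (Fin n)))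

theorem map_monomialInvariants (hm : m ≠ 0) (hz : IsPrimitiveRoot z m) :
    (monomialInvariants k n m H).map (weylEmbedding k n) = (weylEmbedding k n).range ⊓
      invSkewMonoidRing (shiftMonoid k n m) (H.map (permRat k n)) := by
  ext y
  constructor
  · rintro ⟨u, hu, rfl⟩
    exact ⟨⟨u, rfl⟩, (invariant_iff_weylEmbedding_mem hm hz).1 (mem_monomialInvariants.1 hu)⟩
  · rintro ⟨⟨u, rfl⟩, hu⟩
    exact ⟨u, mem_monomialInvariants.2 ((invariant_iff_weylEmbedding_mem hm hz).2 hu), rfl⟩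

theorem map_adjoin_t_inf_monomialInvariants (hm : m ≠ 0) (hz : IsPrimitiveRoot z m) :
    (Algebra.adjoin k (Set.range (t k)) ⊓ monomialInvariants k n m H).map (weylEmbedding k n) =
      (fixedSubalgebra (polyRange k n) (H.map (permRat k n))).map (skewCoeff k (RatField k n)) := by
  rw [Algebra.map_inf _ weylEmbedding_injective, map_monomialInvariants H hm hz, map_adjoin_t,
    ← inf_assoc, inf_eq_left.2 (isSkewOrder_range_weylEmbedding m).map_le,
    map_fixedSubalgebra _ (shiftMonoid k n m)]

theorem isHarishChandra_monomialInvariants (hm : m ≠ 0) (hz : IsPrimitiveRoot z m) :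
    IsHarishChandra (Algebra.adjoin k (Set.range (t k)) ⊓ monomialInvariants k n m H)
      (monomialInvariants k n m H) := by
  refine IsHarishChandra.of_map (f := weylEmbedding k n) weylEmbedding_injective ?_
  rw [map_adjoin_t_inf_monomialInvariants H hm hz, map_monomialInvariants H hm hz]
  exact (isSkewOrder_range_weylEmbedding m).isHarishChandra (map_permRat_le_autStabilizer H)
    (shiftMonoid_le_autStabilizer m)

theorem isGaloisOrder_monomialInvariants (hm : m ≠ 0) (hz : IsPrimitiveRoot z m) :
    IsGaloisOrder (shiftMonoid k n m) (H.map (permRat k n))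
      ((Algebra.adjoin k (Set.range (t k)) ⊓ monomialInvariants k n m H).map (weylEmbedding k n))
      ((monomialInvariants k n m H).map (weylEmbedding k n)) := by
  have hfg := (monomialInvariants_fg (k := k) hm H).map (weylEmbedding k n)
  rw [map_monomialInvariants H hm hz] at hfg
  rw [map_adjoin_t_inf_monomialInvariants H hm hz, map_monomialInvariants H hm hz]
  refine (isSkewOrder_range_weylEmbedding m).isGaloisOrder (map_permRat_le_autStabilizer H)
    (shiftMonoid_le_autStabilizer m) ?_ (fun _ hg _ hh => eq_of_inv_mul_mem_map_permRat hg hh) hfg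
  rintro _ ⟨π, -, rfl⟩ g hg
  exact permRat_conj_mem_shiftMonoid π hg

end Invariants

end

theorem theorem1p1_general (k : Type*) [Field k] [CharZero k] (n : ℕ) {m : ℕ} (hm : m ≠ 0)
    {z : k} (hz : IsPrimitiveRoot z m) :
    Function.Injective (weylEmbedding k n) ∧
    (weylEmbedding k n).range ≤ skewMonoidRing (shiftMonoid k n 1) ∧
    (IsHarishChandra (tInvariants (shephardToddAct k n m))
        (weylInvariants (shephardToddAct k n m)) ∧
      IsGaloisOrder (shiftMonoid k n m) (permRat k n).range
        ((tInvariants (shephardToddAct k n m)).map (weylEmbedding k n))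
        ((weylInvariants (shephardToddAct k n m)).map (weylEmbedding k n))) ∧
    (IsHarishChandra (tInvariants (alternatingAct k n)) (weylInvariants (alternatingAct k n)) ∧
      IsGaloisOrder (shiftMonoid k n 1) ((alternatingGroup (Fin n)).map (permRat k n))
        ((tInvariants (alternatingAct k n)).map (weylEmbedding k n))
        ((weylInvariants (alternatingAct k n)).map (weylEmbedding k n))) ∧
    (IsHarishChandra (tInvariants (cyclicAct k n m)) (weylInvariants (cyclicAct k n m)) ∧
      IsGaloisOrder (shiftMonoid k n m) ⊥
        ((tInvariants (cyclicAct k n m)).map (weylEmbedding k n))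
        ((weylInvariants (cyclicAct k n m)).map (weylEmbedding k n))) := by
  rw [MonoidHom.range_eq_map, ← Subgroup.map_bot (permRat k n)]
  simp only [tInvariants, weylInvariants_shephardToddAct, weylInvariants_alternatingAct,
    weylInvariants_cyclicAct]
  exact ⟨weylEmbedding_injective, range_weylEmbedding_le,
    ⟨isHarishChandra_monomialInvariants _ hm hz, isGaloisOrder_monomialInvariants _ hm hz⟩,
    ⟨isHarishChandra_monomialInvariants _ one_ne_zero .one,
      isGaloisOrder_monomialInvariants _ one_ne_zero .one⟩,
    ⟨isHarishChandra_monomialInvariants _ hm hz, isGaloisOrder_monomialInvariants _ hm hz⟩⟩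

theorem theorem1p1 (k : Type*) [Field k] [IsAlgClosed k] [CharZero k] (n m : ℕ)
    (hn : 1 ≤ n) (hm : 1 ≤ m) :
    Function.Injective (weylEmbedding k n) ∧
    (weylEmbedding k n).range ≤ skewMonoidRing (shiftMonoid k n 1) ∧
    -- the group `G(m,1,n)`
    (IsHarishChandra (tInvariants (shephardToddAct k n m))
        (weylInvariants (shephardToddAct k n m)) ∧
      IsGaloisOrder (shiftMonoid k n m) (permRat k n).range
        ((tInvariants (shephardToddAct k n m)).map (weylEmbedding k n))
        ((weylInvariants (shephardToddAct k n m)).map (weylEmbedding k n))) ∧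
    -- the alternating group
    (IsHarishChandra (tInvariants (alternatingAct k n)) (weylInvariants (alternatingAct k n)) ∧
      IsGaloisOrder (shiftMonoid k n 1) ((alternatingGroup (Fin n)).map (permRat k n))
        ((tInvariants (alternatingAct k n)).map (weylEmbedding k n))
        ((weylInvariants (alternatingAct k n)).map (weylEmbedding k n))) ∧
    -- the product of `n` cyclic groups of order `m`
    (IsHarishChandra (tInvariants (cyclicAct k n m)) (weylInvariants (cyclicAct k n m)) ∧
      IsGaloisOrder (shiftMonoid k n m) ⊥
        ((tInvariants (cyclicAct k n m)).map (weylEmbedding k n))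
        ((weylInvariants (cyclicAct k n m)).map (weylEmbedding k n))) := by
  have : NeZero (m : k) := ⟨Nat.cast_ne_zero.2 (Nat.one_le_iff_ne_zero.1 hm)⟩
  obtain ⟨z, hz⟩ := HasEnoughRootsOfUnity.exists_primitiveRoot k m
  exact theorem1p1_general k n (Nat.one_le_iff_ne_zero.1 hm) hz
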